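/- **Setting.** Let $K,N_t,N_r$ be integers with $K<N_t<N_r$, let $\theta\in\mathbb R$, let $\mathbf H=[\mathbf h_1,\dots,\mathbf h_K]^H\in\mathbb C^{K\times N_t}$, let $\Gamma_1,\dots,\Gamma_K>0$, $\sigma_C>0$, and $P_T\in\mathbb R$. Let $\mathbf a=\mathbf a(\theta)=\big[e^{-j\frac{N_t-1}{2}\pi\sin\theta},e^{-j\frac{N_t-3}{2}\pi\sin\theta},\dots,e^{j\frac{N_t-1}{2}\pi\sin\theta}\big]^T$, let $\mathbf b=\mathbf b(\theta)\in\mathbb C^{N_r}$ be given by the same formula with $N_r$ in place of $N_t$, and put $\mathbf A(\theta)=\mathbf b(\theta)\mathbf a(\theta)^H$, $\dot{\mathbf a}=\partial\mathbf a/\partial\theta$, $\dot{\mathbf A}=\partial\mathbf A/\partial\theta$, $\mathbf Q_k=\mathbf h_k\mathbf h_k^H$. For a matrix $\mathbf R\in\mathbb C^{N_t\times N_t}$ and $t\in\mathbb R$ let $$\mathbf P(\mathbf R,t)=\begin{bmatrix}\operatorname{tr}(\dot{\mathbf A}^H\dot{\mathbf A}\mathbf R)-t&\operatorname{tr}(\dot{\mathbf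 A}^H\mathbf A\mathbf R)\\ \operatorname{tr}(\mathbf A^H\dot{\mathbf A}\mathbf R)&\operatorname{tr}(\mathbf A^H\mathbf A\mathbf R)\end{bmatrix}.$$ The *beamforming problem* (minimization of the Cramér–Rao bound of the angle of a point target in epigraph form) is to minimize $-t$ over $\mathbf w_1,\dots,\mathbf w_K\in\mathbb C^{N_t}$, $\mathbf R_X$ and $t\in\mathbb R$ subject to $\mathbf P(\mathbf R_X,t)\succeq 0$, $\frac{|\mathbf h_k^H\mathbf w_k|^2}{\sum_{i\ne k}|\mathbf h_k^H\mathbf w_i|^2+\sigma_C^2}\ge\Gamma_k$ for all $k$, $\sum_k\operatorname{tr}(\mathbf w_k\mathbf w_k^H)\le P_T$, and $\mathbf R_X=\sum_k\mathbf w_k\mathbf w_k^H$. Its *semidefinite relaxation* is to minimize $-t$ over $\mathbf W_1,\dots,\mathbf W_K\succeq 0$ in $\mathbb C^{N_t\times N_t}$ and $t\in\mathbb R$ subject to $\mathbf P(\sum_k\mathbf W_k,t)\succeq 0$, $\operatorname{tr}(\mathbf Q_k\mathbf W_k)-\Gamma_k\sum_{i\ne k}\operatorname{tr}(\mathbf Q_k\mathbf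 W_i)\ge\Gamma_k\sigma_C^2$ for all $k$, and $\sum_k\operatorname{tr}(\mathbf W_k)\le P_T$. **Theorem.** Suppose that the semidefinite relaxation is feasible and that $\mathbf H[\mathbf a,\dot{\mathbf a}]\in\mathbb C^{K\times 2}$ has full column rank. Then: 1. The relaxation always has a rank-one optimal solution. More precisely, for every optimal solution $(\{\mathbf W_k\},t)$ there is an optimal solution $(\{\mathbf W_k'\},t)$ with $\sum_k\mathbf W_k'=\sum_k\mathbf W_k$ and $\operatorname{rank}(\mathbf W_k')=1$ for every $k$. 2. Every optimal solution $(\{\mathbf W_k\},t)$ itself satisfies $\operatorname{rank}(\mathbf W_k)=1$ for all $k$, except possibly for users $k$ whose channels $\mathbf h_k$ are orthogonal to one common nonzero vector $\mathbf v\in\operatorname{span}\{\mathbf a,\dot{\mathbf a}\}$ (which may depend on the solution). 3. The relaxation is tight: the relaxation and the beamforming problem both attain their minimum, and the two minimum values are equal. 4. The relaxation gives the global optimum of the beamforming problem: if $(\{\mathbf W_k\},t)$ is an optimal solution of the relaxation with all $\operatorname{rank}(\mathbf W_k)=1$, then there are $\mathbf w_k$ with $\mathbf W_k=\mathbf w_k\mathbf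 w_k^H$ for all $k$, and for any such $\mathbf w_k$ the triple $(\{\mathbf w_k\},\sum_k\mathbf W_k,t)$ is a global optimum of the beamforming problem. -/

import Mathlib

open Matrix
open scoped ComplexOrder

noncomputable section

namespace DFRC

/-- Steering vector at azimuth angle `θ` of a uniform linear array of `N` antennas with
half-wavelength spacing, with the centre of the array as the reference point: the entries are
`exp (-j (N-1)/2 π sin θ), exp (-j (N-3)/2 π sin θ), …, exp (j (N-1)/2 π sin θ)`. -/
def steering (N : ℕ) (θ : ℝ) : Fin N → ℂ := fun n =>
  Complex.exp (Complex.I *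
    (((((n : ℕ) : ℝ) - ((N : ℝ) - 1) / 2) * Real.pi * Real.sin θ : ℝ) : ℂ))

/-- Entrywise derivative of the steering vector with respect to the angle. -/
def steeringDot (N : ℕ) (θ : ℝ) : Fin N → ℂ := fun n =>
  deriv (fun ϑ : ℝ => steering N ϑ n) θ

/-- The matrix `A(θ) = b(θ) a(θ)ᴴ`, where `a` and `b` are the transmit and receive
steering vectors. -/
def responseMat (Nr Nt : ℕ) (θ : ℝ) : Matrix (Fin Nr) (Fin Nt) ℂ :=
  vecMulVec (steering Nr θ) (star (steering Nt θ))

/-- Entrywise derivative of `A(θ)` with respect to the angle. -/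
def responseMatDot (Nr Nt : ℕ) (θ : ℝ) : Matrix (Fin Nr) (Fin Nt) ℂ :=
  Matrix.of fun i j => deriv (fun ϑ : ℝ => responseMat Nr Nt ϑ i j) θ

/-- The `Nt × 2` matrix whose columns are `a(θ)` and its derivative. -/
def steeringPair (Nt : ℕ) (θ : ℝ) : Matrix (Fin Nt) (Fin 2) ℂ :=
  Matrix.of fun i => ![steering Nt θ i, steeringDot Nt θ i]

/-- The channel vector `h_k`, where `H = [h_1, …, h_K]ᴴ`. -/
def channelVec {K Nt : ℕ} (H : Matrix (Fin K) (Fin Nt) ℂ) (k : Fin K) : Fin Nt → ℂ :=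
  star (H k)

/-- `Q_k = h_k h_kᴴ`. -/
def channelGram {K Nt : ℕ} (H : Matrix (Fin K) (Fin Nt) ℂ) (k : Fin K) :
    Matrix (Fin Nt) (Fin Nt) ℂ :=
  vecMulVec (channelVec H k) (star (channelVec H k))

/-- The `2 × 2` matrix of the linear matrix inequality which expresses the minimization of the
Cramér–Rao bound of the target angle, for transmit covariance `R` and epigraph variable `t`. -/
def crbMat (Nr : ℕ) {Nt : ℕ} (θ : ℝ) (R : Matrix (Fin Nt) (Fin Nt) ℂ) (t : ℝ) :
    Matrix (Fin 2) (Fin 2) ℂ :=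
  !![((responseMatDot Nr Nt θ)ᴴ * responseMatDot Nr Nt θ * R).trace - (t : ℂ),
      ((responseMatDot Nr Nt θ)ᴴ * responseMat Nr Nt θ * R).trace;
    ((responseMat Nr Nt θ)ᴴ * responseMatDot Nr Nt θ * R).trace,
      ((responseMat Nr Nt θ)ᴴ * responseMat Nr Nt θ * R).trace]

/-- Feasibility of `({w_k}, R, t)` for the beamforming problem (objective: minimize `-t`). -/
structure BeamFeasible {K Nt : ℕ} (Nr : ℕ) (θ : ℝ) (H : Matrix (Fin K) (Fin Nt) ℂ)
    (Γ : Fin K → ℝ) (σC PT : ℝ) (w : Fin K → Fin Nt → ℂ)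
    (R : Matrix (Fin Nt) (Fin Nt) ℂ) (t : ℝ) : Prop where
  crb : (crbMat Nr θ R t).PosSemidef
  sinr : ∀ k, Γ k ≤ ‖star (channelVec H k) ⬝ᵥ w k‖ ^ 2 /
    (∑ i ∈ Finset.univ.erase k, ‖star (channelVec H k) ⬝ᵥ w i‖ ^ 2 + σC ^ 2)
  power : ∑ k, (vecMulVec (w k) (star (w k))).trace.re ≤ PT
  cov : R = ∑ k, vecMulVec (w k) (star (w k))

/-- Global optimality of `({w_k}, R, t)` for the beamforming problem. -/
def BeamOptimal {K Nt : ℕ} (Nr : ℕ) (θ : ℝ) (H : Matrix (Fin K) (Fin Nt) ℂ)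
    (Γ : Fin K → ℝ) (σC PT : ℝ) (w : Fin K → Fin Nt → ℂ)
    (R : Matrix (Fin Nt) (Fin Nt) ℂ) (t : ℝ) : Prop :=
  BeamFeasible Nr θ H Γ σC PT w R t ∧
    ∀ w' R' t', BeamFeasible Nr θ H Γ σC PT w' R' t' → -t ≤ -t'

/-- Feasibility of `({W_k}, t)` for the semidefinite relaxation (objective: minimize `-t`).
The traces in `sinr` and `power` are real, because the matrices are positive semidefinite. -/
structure SDRFeasible {K Nt : ℕ} (Nr : ℕ) (θ : ℝ) (H : Matrix (Fin K) (Fin Nt) ℂ)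
    (Γ : Fin K → ℝ) (σC PT : ℝ) (W : Fin K → Matrix (Fin Nt) (Fin Nt) ℂ) (t : ℝ) : Prop where
  crb : (crbMat Nr θ (∑ k, W k) t).PosSemidef
  sinr : ∀ k, Γ k * σC ^ 2 ≤ (channelGram H k * W k).trace.re -
    Γ k * ∑ i ∈ Finset.univ.erase k, (channelGram H k * W i).trace.re
  power : ∑ k, (W k).trace.re ≤ PT
  psd : ∀ k, (W k).PosSemidef

/-- Optimality of `({W_k}, t)` for the semidefinite relaxation. -/
def SDROptimal {K Nt : ℕ} (Nr : ℕ) (θ : ℝ) (H : Matrix (Fin K) (Fin Nt) ℂ)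
    (Γ : Fin K → ℝ) (σC PT : ℝ) (W : Fin K → Matrix (Fin Nt) (Fin Nt) ℂ) (t : ℝ) : Prop :=
  SDRFeasible Nr θ H Γ σC PT W t ∧
    ∀ W' t', SDRFeasible Nr θ H Γ σC PT W' t' → -t ≤ -t'

end DFRC

end

noncomputable section

namespace DFRC

/-! Write `d` for the derivative of the transmit vector `a`. At an optimum, separating the
attainable slacks from the open cone of strict improvements gives Fritz John multipliers without any
constraint qualification (`exists_multipliers`). The dual slack of user `k` is `M_k = B - l_k (1 +
Γ_k) Q_k`, where `B = μ I - F + ∑ l_i Γ_i Q_i` is common to all users and the weight `F` has range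
in `span {a, d}`; moreover `M_k` is positive semidefinite and `M_k W_k = 0`. Since `t ≥ 0` at an
optimum, `μ = 0` would make every multiplier vanish, so `μ > 0`.

If `B u = 0`, positivity of `M_k` at `u` forces `l_k = 0` or `h_kᴴ u = 0` for every `k`, hence `F u
= μ u`. On `span {a, d}` the weight is a two by two operator. It is not `μ` times the identity,
because `Nt < Nr` gives `‖b‖² ‖d‖² < ‖ḃ‖² ‖a‖²`. Hence `ker B` is at most a line, spanned by some
`v` in `span {a, d}` (`exists_span_of_weight_eigen`).

Splitting off the rank-one part of `W_k` through `W_k h_k` leaves a positive semidefinite residual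
killed by `h_k` and by `M_k`, hence by `B`; so it is a multiple of `v vᴴ` (`optimal_structure`). By
the rank hypothesis some `h_m` is not orthogonal to `v`; then `l_m = 0`, `M_m = B`, and `W_m` itself
is a multiple of `v vᴴ`. Giving all residuals to user `m` keeps the covariance, reduces no useful
signal, and makes every rank one (`exists_rank_one_optimal`). Tightness follows, as the beamforming
problem is the relaxation restricted to outer squares. -/

/-! ### Positive semidefinite and rank-one matrices -/

theorem trace_vecMulVec_mul {n : ℕ} (x y : Fin n → ℂ) (R : Matrix (Fin n) (Fin n) ℂ) :
    (vecMulVec x (star y) * R).trace = star y ⬝ᵥ R *ᵥ x := by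
  rw [vecMulVec_mul, trace_vecMulVec, dotProduct_comm, ← dotProduct_mulVec]

theorem trace_vecMulVec_star_mul {n : ℕ} (x : Fin n → ℂ) (M : Matrix (Fin n) (Fin n) ℂ) :
    (vecMulVec x (star x) * M).trace = star x ⬝ᵥ M *ᵥ x :=
  trace_vecMulVec_mul x x M

theorem trace_mul_vecMulVec_star {n : ℕ} (x : Fin n → ℂ) (M : Matrix (Fin n) (Fin n) ℂ) :
    (M * vecMulVec x (star x)).trace = star x ⬝ᵥ M *ᵥ x := by
  rw [trace_mul_comm, trace_vecMulVec_star_mul]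

theorem trace_mul_re_nonneg {n : ℕ} {M W : Matrix (Fin n) (Fin n) ℂ} (hM : M.PosSemidef)
    (hW : W.PosSemidef) : 0 ≤ (M * W).trace.re := by
  obtain ⟨m, v, rfl⟩ := posSemidef_iff_eq_sum_vecMulVec.1 hW
  rw [Matrix.mul_sum, trace_sum, Complex.re_sum]
  refine Finset.sum_nonneg fun i _ => ?_
  rw [trace_mul_vecMulVec_star]
  exact (Complex.nonneg_iff.1 (hM.dotProduct_mulVec_nonneg _)).1

/-- Complementary slackness: with `W` a sum of outer squares, the trace is a sum of nonnegative
values of the form of `M`, and a positive semidefinite form vanishes only on the kernel. -/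
theorem mul_eq_zero_of_trace_re_eq_zero {n : ℕ} {M W : Matrix (Fin n) (Fin n) ℂ}
    (hM : M.PosSemidef) (hW : W.PosSemidef) (h : (M * W).trace.re = 0) : M * W = 0 := by
  obtain ⟨m, v, rfl⟩ := posSemidef_iff_eq_sum_vecMulVec.1 hW
  have hn : ∀ i, 0 ≤ star (v i) ⬝ᵥ M *ᵥ (v i) := fun i => hM.dotProduct_mulVec_nonneg _
  rw [Matrix.mul_sum, trace_sum, Complex.re_sum] at h
  simp_rw [trace_mul_vecMulVec_star] at h
  rw [Finset.sum_eq_zero_iff_of_nonneg fun i _ => (Complex.nonneg_iff.1 (hn i)).1] at h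
  rw [Matrix.mul_sum]
  refine Finset.sum_eq_zero fun i hi => ?_
  have h0 : star (v i) ⬝ᵥ M *ᵥ (v i) = 0 :=
    Complex.ext (h i hi) (Complex.nonneg_iff.1 (hn i)).2.symm
  rw [mul_vecMulVec, (hM.dotProduct_mulVec_zero_iff _).1 h0, zero_vecMulVec]

theorem posSemidef_fin_two {p q : ℝ} {z : ℂ} :
    (!![(p : ℂ), z; star z, (q : ℂ)]).PosSemidef ↔ 0 ≤ p ∧ 0 ≤ q ∧ z.re ^ 2 + z.im ^ 2 ≤ p * q := by
  constructor
  · intro h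
    refine ⟨?_, ?_, ?_⟩
    · simpa using h.diag_nonneg (i := 0)
    · simpa using h.diag_nonneg (i := 1)
    · have := (Complex.nonneg_iff.1 h.det_nonneg).1
      simp [det_fin_two] at this
      nlinarith
  · rintro ⟨hp, hq, hz⟩
    refine PosSemidef.of_dotProduct_mulVec_nonneg ?_ fun x => ?_
    · ext i j
      fin_cases i <;> fin_cases j <;> simp [conjTranspose_apply]
    · rw [Complex.nonneg_iff]
      simp only [dotProduct, mulVec, Fin.sum_univ_two, Pi.star_apply]
      simp
      constructor
      · generalize (x 0).re = s, (x 0).im = s', (x 1).re = r, (x 1).im = r', z.re = u,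
          z.im = u' at *
        rcases hp.eq_or_lt with rfl | hp
        · have h1 : u = 0 := by nlinarith [sq_nonneg u, sq_nonneg u']
          have h2 : u' = 0 := by nlinarith [sq_nonneg u, sq_nonneg u']
          subst h1 h2
          nlinarith [mul_nonneg hq (sq_nonneg r), mul_nonneg hq (sq_nonneg r')]
        -- After multiplication by `p` the form is a sum of two squares plus the determinant times
        -- `|x 1|²`.
        · refine nonneg_of_mul_nonneg_right (a := p) ?_ hp
          have h1 := mul_nonneg (sub_nonneg.2 hz) (add_nonneg (sq_nonneg r) (sq_nonneg r'))
          nlinarith [sq_nonneg (p * s + u * r - u' * r'), sq_nonneg (p * s' + u * r' + u' * r)]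
      · ring

/-- Used with `x = h_k`: the residual of `W_k` contributes nothing to the useful signal of user `k`.
-/
theorem sub_rankOne_mulVec {n : ℕ} {W : Matrix (Fin n) (Fin n) ℂ} (hW : W.PosSemidef)
    {x : Fin n → ℂ} {s : ℂ} (hs : star x ⬝ᵥ W *ᵥ x = s) (hs0 : s ≠ 0) :
    (W - s⁻¹ • vecMulVec (W *ᵥ x) (star (W *ᵥ x))) *ᵥ x = 0 := by
  have hvm : star x ᵥ* W = star (W *ᵥ x) := by rw [star_mulVec, hW.1.eq]
  rw [sub_mulVec, smul_mulVec, vecMulVec_mulVec, ← hvm, ← dotProduct_mulVec, hs]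
  simp [smul_smul, inv_mul_cancel₀ hs0]

/-- The residual of a positive semidefinite matrix after the rank-one part through `W x`. -/
theorem posSemidef_sub_rankOne {n : ℕ} {W : Matrix (Fin n) (Fin n) ℂ} (hW : W.PosSemidef)
    {x : Fin n → ℂ} {s : ℂ} (hs : star x ⬝ᵥ W *ᵥ x = s) (hs0 : s ≠ 0) :
    (W - s⁻¹ • vecMulVec (W *ᵥ x) (star (W *ᵥ x))).PosSemidef := by
  have hreal : star s = s := by
    have := (Complex.nonneg_iff.1 (hs ▸ hW.dotProduct_mulVec_nonneg x)).2
    exact Complex.conj_eq_iff_im.2 this.symm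
  have hvm : star x ᵥ* W = star (W *ᵥ x) := by rw [star_mulVec, hW.1.eq]
  -- The residual is a congruence of `W`; the cross terms collapse because the residual kills `x`.
  have key : W - s⁻¹ • vecMulVec (W *ᵥ x) (star (W *ᵥ x)) =
      (1 - s⁻¹ • vecMulVec x (star (W *ᵥ x)))ᴴ * W * (1 - s⁻¹ • vecMulVec x (star (W *ᵥ x))) := by
    have hinv : star s⁻¹ = s⁻¹ := by rw [star_inv₀, hreal]
    simp only [conjTranspose_sub, conjTranspose_one, conjTranspose_smul, conjTranspose_vecMulVec,
      star_star, Matrix.sub_mul, Matrix.mul_sub, Matrix.one_mul, Matrix.mul_one, Matrix.smul_mul,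
      Matrix.mul_smul, vecMulVec_mul, mul_vecMulVec, hvm, hinv]
    rw [sub_rankOne_mulVec hW hs hs0]
    simp
  rw [key]
  exact hW.conjTranspose_mul_mul_same _

theorem star_form {n : ℕ} {W : Matrix (Fin n) (Fin n) ℂ} (hW : W.IsHermitian)
    (x y : Fin n → ℂ) : star y ⬝ᵥ W *ᵥ x = star (star x ⬝ᵥ W *ᵥ y) := by
  rw [star_dotProduct, star_mulVec, hW.eq, ← dotProduct_mulVec]

/-- Cauchy–Schwarz for the form of a positive semidefinite matrix. -/
theorem norm_sq_form_le {n : ℕ} {W : Matrix (Fin n) (Fin n) ℂ} (hW : W.PosSemidef)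
    (x y : Fin n → ℂ) :
    (star x ⬝ᵥ W *ᵥ y).re ^ 2 + (star x ⬝ᵥ W *ᵥ y).im ^ 2 ≤
      (star x ⬝ᵥ W *ᵥ x).re * (star y ⬝ᵥ W *ᵥ y).re := by
  have h := hW.conjTranspose_mul_mul_same (Matrix.of fun i => ![x i, y i])
  have hre : ∀ u : Fin n → ℂ, star u ⬝ᵥ W *ᵥ u = ((star u ⬝ᵥ W *ᵥ u).re : ℂ) := fun u =>
    Complex.ext rfl (by simpa using (Complex.nonneg_iff.1 (hW.dotProduct_mulVec_nonneg u)).2.symm)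
  have he : (Matrix.of fun i => ![x i, y i])ᴴ * W * (Matrix.of fun i => ![x i, y i]) =
      !![((star x ⬝ᵥ W *ᵥ x).re : ℂ), star x ⬝ᵥ W *ᵥ y;
        star (star x ⬝ᵥ W *ᵥ y), ((star y ⬝ᵥ W *ᵥ y).re : ℂ)] := by
    rw [← hre, ← hre, ← star_form hW.1, Matrix.mul_assoc]
    ext i j
    fin_cases i <;> fin_cases j <;> rfl
  rw [he] at h
  exact (posSemidef_fin_two.1 h).2.2

/-- A positive semidefinite matrix whose columns lie on the line through `v`. -/
theorem exists_eq_smul_vecMulVec {n : ℕ} {D : Matrix (Fin n) (Fin n) ℂ}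
    (hD : D.PosSemidef) {v : Fin n → ℂ} (hv : v ≠ 0) (h : ∀ j, ∃ r : ℂ, ∀ i, D i j = r * v i) :
    ∃ c : ℝ, 0 ≤ c ∧ D = (c : ℂ) • vecMulVec v (star v) := by
  obtain ⟨i₀, hi₀⟩ := Function.ne_iff.1 hv
  choose r hr using h
  simp only [Pi.zero_apply] at hi₀
  -- Hermitian symmetry between row and column `i₀` determines every column coefficient `r j` from
  -- `r i₀`.
  have hD' : D = (star (r i₀) / v i₀) • vecMulVec v (star v) := by
    ext i j
    have h1 : star (D j i₀) = D i₀ j := hD.1.apply _ _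
    rw [hr, hr, star_mul'] at h1
    simp only [Matrix.smul_apply, vecMulVec_apply, Pi.star_apply, smul_eq_mul, hr]
    field_simp
    linear_combination (v i) * (-h1)
  have h2 := hD.diag_nonneg (i := i₀)
  rw [hD'] at h2
  simp only [Matrix.smul_apply, vecMulVec_apply, Pi.star_apply, smul_eq_mul] at h2
  have h3 : 0 < Complex.normSq (v i₀) := Complex.normSq_pos.2 hi₀
  generalize star (r i₀) / v i₀ = c at h2 hD'
  rw [Complex.star_def, Complex.mul_conj, Complex.nonneg_iff, Complex.re_mul_ofReal,
    Complex.im_mul_ofReal] at h2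
  have h4 : c = (c.re : ℂ) :=
    Complex.ext rfl (by simpa using (mul_eq_zero.1 h2.2.symm).resolve_right h3.ne')
  exact ⟨c.re, nonneg_of_mul_nonneg_left h2.1 h3, h4 ▸ hD'⟩

theorem rank_vecMulVec_eq_one {n : ℕ} {v w : Fin n → ℂ} (h : vecMulVec v w ≠ 0) :
    (vecMulVec v w).rank = 1 := by
  refine le_antisymm (rank_vecMulVec_le _ _) (Nat.one_le_iff_ne_zero.2 fun h0 => h ?_)
  rw [Matrix.rank, Submodule.finrank_eq_zero, LinearMap.range_eq_bot] at h0
  ext i j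
  simpa using congrFun (LinearMap.congr_fun h0 (Pi.single j 1)) i

theorem rank_smul_vecMulVec_eq_one {n : ℕ} {c : ℂ} {v w : Fin n → ℂ}
    (h : c • vecMulVec v w ≠ 0) : (c • vecMulVec v w).rank = 1 := by
  rw [← smul_vecMulVec] at h ⊢
  exact rank_vecMulVec_eq_one h

/-- A positive semidefinite matrix of rank one is an outer square. -/
theorem exists_eq_vecMulVec_of_rank_eq_one {n : ℕ} {W : Matrix (Fin n) (Fin n) ℂ}
    (hW : W.PosSemidef) (h : W.rank = 1) : ∃ w, W = vecMulVec w (star w) := by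
  rw [Matrix.rank, finrank_eq_one_iff'] at h
  obtain ⟨⟨v, hvW⟩, hv, h⟩ := h
  have hv : v ≠ 0 := fun h0 => hv (Subtype.ext h0)
  obtain ⟨c, hc, rfl⟩ := exists_eq_smul_vecMulVec hW hv fun j => by
    obtain ⟨r, hr⟩ := h ⟨W *ᵥ Pi.single j 1, ⟨Pi.single j 1, rfl⟩⟩
    refine ⟨r, fun i => ?_⟩
    have := congrFun (congrArg Subtype.val hr) i
    simpa [eq_comm] using this
  refine ⟨((Real.sqrt c : ℝ) : ℂ) • v, ?_⟩
  rw [star_smul, smul_vecMulVec, vecMulVec_smul, smul_smul, Complex.star_def, Complex.conj_ofReal,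
    ← Complex.ofReal_mul, Real.mul_self_sqrt hc]

/-! ### Steering vectors and the Cramér–Rao matrix -/

/-- The phase slope `(n - (N-1)/2) π cos θ` of the `n`-th antenna. -/
def phaseSlope (N : ℕ) (θ : ℝ) (n : Fin N) : ℝ :=
  (((n : ℕ) : ℝ) - ((N : ℝ) - 1) / 2) * Real.pi * Real.cos θ

theorem hasDerivAt_steering (N : ℕ) (θ : ℝ) (n : Fin N) :
    HasDerivAt (fun ϑ : ℝ => steering N ϑ n)
      (Complex.I * phaseSlope N θ n * steering N θ n) θ := by
  have h := ((Real.hasDerivAt_sin θ).const_mul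
    ((((n : ℕ) : ℝ) - ((N : ℝ) - 1) / 2) * Real.pi)).ofReal_comp
  have h2 := (h.const_mul Complex.I).cexp
  refine h2.congr_deriv ?_
  simp only [phaseSlope, steering]
  ring

theorem steeringDot_apply (N : ℕ) (θ : ℝ) (n : Fin N) :
    steeringDot N θ n = Complex.I * phaseSlope N θ n * steering N θ n :=
  (hasDerivAt_steering N θ n).deriv

theorem star_steering_mul_steering (N : ℕ) (θ : ℝ) (n : Fin N) :
    star (steering N θ n) * steering N θ n = 1 := by
  rw [steering, Complex.star_def, ← Complex.exp_conj, ← Complex.exp_add, map_mul,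
    Complex.conj_I, Complex.conj_ofReal]
  simp

theorem star_steering_dotProduct_steering (N : ℕ) (θ : ℝ) :
    star (steering N θ) ⬝ᵥ steering N θ = ((N : ℝ) : ℂ) := by
  simp [dotProduct, star_steering_mul_steering, -Complex.star_def, -RCLike.star_def]

theorem sum_range_sub_sq (M : ℕ) (c : ℝ) :
    ∑ n ∈ Finset.range M, ((n : ℝ) - c) ^ 2 =
      M * (M - 1) * (2 * M - 1) / 6 - c * M * (M - 1) + M * c ^ 2 := by
  induction M with
  | zero => simp
  | succ k ih => rw [Finset.sum_range_succ, ih]; push_cast; ring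

theorem sum_range_sub (M : ℕ) (c : ℝ) :
    ∑ n ∈ Finset.range M, ((n : ℝ) - c) = M * (M - 1) / 2 - M * c := by
  induction M with
  | zero => simp
  | succ k ih => rw [Finset.sum_range_succ, ih]; push_cast; ring

theorem sum_phaseSlope (N : ℕ) (θ : ℝ) : ∑ n, phaseSlope N θ n = 0 := by
  simp only [phaseSlope]
  rw [← Finset.sum_mul, ← Finset.sum_mul,
    Fin.sum_univ_eq_sum_range (fun n => (n : ℝ) - ((N : ℝ) - 1) / 2), sum_range_sub]
  ring

theorem sum_phaseSlope_sq (N : ℕ) (θ : ℝ) :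
    ∑ n, phaseSlope N θ n ^ 2 = (Real.pi * Real.cos θ) ^ 2 * (N * ((N : ℝ) ^ 2 - 1) / 12) := by
  simp only [phaseSlope, mul_pow]
  rw [← Finset.sum_mul, ← Finset.sum_mul,
    Fin.sum_univ_eq_sum_range (fun n => ((n : ℝ) - ((N : ℝ) - 1) / 2) ^ 2), sum_range_sub_sq]
  ring

/-- This is where the reference point at the array centre matters: the phase slopes are
antisymmetric and sum to zero. -/
theorem star_steering_dotProduct_steeringDot (N : ℕ) (θ : ℝ) :
    star (steering N θ) ⬝ᵥ steeringDot N θ = 0 := by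
  have h : ∀ n, star (steering N θ) n * steeringDot N θ n = Complex.I * phaseSlope N θ n := by
    intro n
    rw [steeringDot_apply, Pi.star_apply]
    linear_combination (Complex.I * phaseSlope N θ n) * star_steering_mul_steering N θ n
  rw [dotProduct, Finset.sum_congr rfl fun n _ => h n, ← Finset.mul_sum, ← Complex.ofReal_sum,
    sum_phaseSlope]
  simp

theorem star_steeringDot_dotProduct_steeringDot (N : ℕ) (θ : ℝ) :
    star (steeringDot N θ) ⬝ᵥ steeringDot N θ =
      (((Real.pi * Real.cos θ) ^ 2 * (N * ((N : ℝ) ^ 2 - 1) / 12) : ℝ) : ℂ) := by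
  have h : ∀ n, star (steeringDot N θ) n * steeringDot N θ n = ((phaseSlope N θ n ^ 2 : ℝ) : ℂ) := by
    intro n
    rw [Pi.star_apply, steeringDot_apply, star_mul', star_mul', Complex.star_def,
      Complex.conj_I, Complex.conj_ofReal, ← Complex.star_def]
    push_cast
    linear_combination ((phaseSlope N θ n : ℂ) ^ 2) * star_steering_mul_steering N θ n -
      ((phaseSlope N θ n : ℂ) ^ 2) * star (steering N θ n) * steering N θ n * Complex.I_sq
  rw [dotProduct, Finset.sum_congr rfl fun n _ => h n, ← Complex.ofReal_sum, sum_phaseSlope_sq]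

theorem responseMatDot_eq (Nr Nt : ℕ) (θ : ℝ) :
    responseMatDot Nr Nt θ = vecMulVec (steeringDot Nr θ) (star (steering Nt θ)) +
      vecMulVec (steering Nr θ) (star (steeringDot Nt θ)) := by
  ext i j
  have h := ((hasDerivAt_steering Nr θ i).mul (hasDerivAt_steering Nt θ j).star).deriv
  rw [← steeringDot_apply, ← steeringDot_apply] at h
  exact h

/-- Since the receive vector is orthogonal to its derivative, the mixed terms of the product rule
drop out, and `R` enters only through its form on the pair `a, d`. -/
theorem crbMat_eq (Nr : ℕ) {Nt : ℕ} (θ : ℝ) (R : Matrix (Fin Nt) (Fin Nt) ℂ) (t : ℝ) {c e : ℝ}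
    (hc : star (steering Nr θ) ⬝ᵥ steering Nr θ = c)
    (he : star (steeringDot Nr θ) ⬝ᵥ steeringDot Nr θ = e) :
    crbMat Nr θ R t =
      !![e * (star (steering Nt θ) ⬝ᵥ R *ᵥ steering Nt θ) +
          c * (star (steeringDot Nt θ) ⬝ᵥ R *ᵥ steeringDot Nt θ) - t,
        c * (star (steering Nt θ) ⬝ᵥ R *ᵥ steeringDot Nt θ);
        c * (star (steeringDot Nt θ) ⬝ᵥ R *ᵥ steering Nt θ),
        c * (star (steering Nt θ) ⬝ᵥ R *ᵥ steering Nt θ)] := by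
  have h1 := star_steering_dotProduct_steeringDot Nr θ
  have h2 : star (steeringDot Nr θ) ⬝ᵥ steering Nr θ = 0 := by
    rw [star_dotProduct, h1, star_zero]
  simp only [crbMat, responseMatDot_eq, responseMat, conjTranspose_add, conjTranspose_vecMulVec,
    star_star, Matrix.add_mul, Matrix.mul_add, vecMulVec_mul_vecMulVec, h1, h2, hc, he,
    trace_add, Matrix.smul_mul, trace_smul, trace_vecMulVec_mul, vecMulVec_smul, zero_smul, vecMulVec_zero,
    smul_eq_mul, add_zero, zero_add]

/-! ### Separation from the slack cone -/

section Separation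

variable {κ : Type*}

/-- The interior of the cone of nonnegative slack vectors; the last four of the six extra
coordinates are the entries of a `2 × 2` Hermitian matrix. -/
def strictCone (κ : Type*) : Set (κ ⊕ Fin 6 → ℝ) :=
  {y | (∀ k, 0 < y (.inl k)) ∧ 0 < y (.inr 0) ∧ 0 < y (.inr 1) ∧ 0 < y (.inr 2) ∧
    0 < y (.inr 3) ∧ y (.inr 4) ^ 2 + y (.inr 5) ^ 2 < y (.inr 2) * y (.inr 3)}

/-- The closed version of `strictCone`. -/
def weakCone (κ : Type*) : Set (κ ⊕ Fin 6 → ℝ) :=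
  {y | (∀ k, 0 ≤ y (.inl k)) ∧ 0 ≤ y (.inr 0) ∧ 0 ≤ y (.inr 1) ∧ 0 ≤ y (.inr 2) ∧
    0 ≤ y (.inr 3) ∧ y (.inr 4) ^ 2 + y (.inr 5) ^ 2 ≤ y (.inr 2) * y (.inr 3)}

theorem smul_mem_strictCone {y : κ ⊕ Fin 6 → ℝ} (hy : y ∈ strictCone κ) {r : ℝ} (hr : 0 < r) :
    r • y ∈ strictCone κ := by
  obtain ⟨h, h0, h1, h2, h3, h4⟩ := hy
  refine ⟨fun k => mul_pos hr (h k), mul_pos hr h0, mul_pos hr h1, mul_pos hr h2, mul_pos hr h3, ?_⟩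
  simp only [Pi.smul_apply, smul_eq_mul]
  nlinarith [mul_lt_mul_of_pos_left h4 (mul_pos hr hr)]

theorem add_mem_strictCone {y y' : κ ⊕ Fin 6 → ℝ} (hy : y ∈ weakCone κ)
    (hy' : y' ∈ strictCone κ) : y + y' ∈ strictCone κ := by
  obtain ⟨h, h0, h1, h2, h3, h4⟩ := hy
  obtain ⟨h', h0', h1', h2', h3', h4'⟩ := hy'
  refine ⟨fun k => add_pos_of_nonneg_of_pos (h k) (h' k), add_pos_of_nonneg_of_pos h0 h0',
    add_pos_of_nonneg_of_pos h1 h1', add_pos_of_nonneg_of_pos h2 h2',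
    add_pos_of_nonneg_of_pos h3 h3', ?_⟩
  simp only [Pi.add_apply]
  generalize y (.inr 2) = p, y (.inr 3) = q, y (.inr 4) = u, y (.inr 5) = v, y' (.inr 2) = p',
    y' (.inr 3) = q', y' (.inr 4) = u', y' (.inr 5) = v' at *
  -- The polarized determinant inequality: Cauchy–Schwarz for `(u, v)` and `(u', v')`, then the
  -- arithmetic-geometric mean inequality.
  have key : 2 * (u * u' + v * v') ≤ p * q' + p' * q := by
    refine abs_le_of_sq_le_sq' ?_ (by positivity) |>.2
    have e1 : (u * u' + v * v') ^ 2 ≤ (u ^ 2 + v ^ 2) * (u' ^ 2 + v' ^ 2) := by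
      nlinarith [sq_nonneg (u * v' - v * u')]
    have e2 : (u ^ 2 + v ^ 2) * (u' ^ 2 + v' ^ 2) ≤ (p * q) * (p' * q') := by
      gcongr
    nlinarith [sq_nonneg (p * q' - p' * q)]
  nlinarith

theorem weakCone_of_strictCone {y : κ ⊕ Fin 6 → ℝ} (hy : y ∈ strictCone κ) : y ∈ weakCone κ :=
  ⟨fun k => (hy.1 k).le, hy.2.1.le, hy.2.2.1.le, hy.2.2.2.1.le, hy.2.2.2.2.1.le, hy.2.2.2.2.2.le⟩

theorem convex_strictCone : Convex ℝ (strictCone κ) := by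
  rw [convex_iff_forall_pos]
  intro x hx y hy a b ha hb _
  exact add_mem_strictCone (weakCone_of_strictCone (smul_mem_strictCone hx ha))
    (smul_mem_strictCone hy hb)

theorem isOpen_strictCone [Finite κ] : IsOpen (strictCone κ) := by
  have h : strictCone κ = (⋂ k, {y | 0 < y (.inl k)}) ∩ ({y | 0 < y (.inr 0)} ∩
      ({y | 0 < y (.inr 1)} ∩ ({y | 0 < y (.inr 2)} ∩ ({y | 0 < y (.inr 3)} ∩
      {y | y (.inr 4) ^ 2 + y (.inr 5) ^ 2 < y (.inr 2) * y (.inr 3)})))) := by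
    ext y
    simp [strictCone]
  rw [h]
  refine (isOpen_iInter_of_finite fun k => isOpen_lt (by fun_prop) (by fun_prop)).inter ?_
  refine (isOpen_lt (by fun_prop) (by fun_prop)).inter ?_
  refine (isOpen_lt (by fun_prop) (by fun_prop)).inter ?_
  refine (isOpen_lt (by fun_prop) (by fun_prop)).inter ?_
  refine (isOpen_lt (by fun_prop) (by fun_prop)).inter ?_
  exact isOpen_lt (by fun_prop) (by fun_prop)

/-- The vector with slacks one, whose Hermitian part is the identity. -/
def coneUnit (κ : Type*) : κ ⊕ Fin 6 → ℝ := Sum.elim (fun _ => 1) ![1, 1, 1, 1, 0, 0]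

theorem coneUnit_mem : coneUnit κ ∈ strictCone κ := by
  refine ⟨fun k => ?_, ?_, ?_, ?_, ?_, ?_⟩ <;> simp [coneUnit]

/-- Separation of a convex set from the open slack cone by a functional of the dual cone. -/
theorem exists_separating_functional [Fintype κ] {C : Set (κ ⊕ Fin 6 → ℝ)} (hC : Convex ℝ C)
    (hne : C.Nonempty) (hd : Disjoint (strictCone κ) C) :
    ∃ f : κ ⊕ Fin 6 → ℝ, f ≠ 0 ∧ (∀ y ∈ weakCone κ, 0 ≤ ∑ i, f i * y i) ∧
      ∀ x ∈ C, ∑ i, f i * x i ≤ 0 := by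
  classical
  obtain ⟨f, u, hf, hu⟩ := geometric_hahn_banach_open convex_strictCone isOpen_strictCone hC hd
  have hsum : ∀ x, f x = ∑ i, x i * f (Pi.single i 1) := fun x => by
    refine (LinearMap.pi_apply_eq_sum_univ f.toLinearMap x).trans
      (Finset.sum_congr rfl fun i _ => ?_)
    have : (fun j => if i = j then (1 : ℝ) else 0) = Pi.single i 1 := by
      ext j
      simp [Pi.single_apply, eq_comm]
    rw [this]
    rfl
  have hs : ∀ y ∈ strictCone κ, f y ≤ 0 := by
    intro y hy
    by_contra! h
    -- The factor raises the value of `f` to `|u| + f y`, beyond the bound `u`.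
    have h1 := hf _ (smul_mem_strictCone hy (r := |u| / f y + 1) (by positivity))
    rw [map_smul, smul_eq_mul, add_mul, div_mul_cancel₀ _ h.ne'] at h1
    linarith [le_abs_self u]
  have hu0 : 0 ≤ u := by
    by_contra! h
    have h1 := hf _ coneUnit_mem
    -- The factor makes the value of `f` equal to `u / 2`, which exceeds a negative `u`.
    have h2 := hf _ (smul_mem_strictCone coneUnit_mem (r := u / (2 * f (coneUnit κ)))
      (div_pos_of_neg_of_neg h (by linarith)))
    rw [map_smul, smul_eq_mul, div_mul_eq_mul_div, mul_div_mul_right _ _ (by linarith)] at h2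
    linarith
  have hw : ∀ y ∈ weakCone κ, f y ≤ 0 := by
    intro y hy
    have h1 := hs _ coneUnit_mem
    refine le_of_forall_pos_le_add fun ε hε => ?_
    -- A small multiple of the unit moves `y` into the open cone; the factor is chosen so that this
    -- costs at most `ε`.
    have h2 := hs _ (add_mem_strictCone hy (smul_mem_strictCone coneUnit_mem
      (r := ε / (1 - f (coneUnit κ))) (by apply div_pos <;> linarith)))
    rw [map_add, map_smul, smul_eq_mul] at h2
    have h3 : ε / (1 - f (coneUnit κ)) * (1 - f (coneUnit κ)) = ε :=
      div_mul_cancel₀ _ (by linarith)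
    have h4 : 0 < ε / (1 - f (coneUnit κ)) := by apply div_pos <;> linarith
    nlinarith
  have hneg : ∀ x, ∑ i, -f (Pi.single i 1) * x i = -f x := fun x => by
    rw [hsum x, ← Finset.sum_neg_distrib]
    exact Finset.sum_congr rfl fun i _ => by ring
  refine ⟨fun i => -f (Pi.single i 1), fun h0 => ?_, fun y hy => ?_, fun x hx => ?_⟩
  · have hf0 : ∀ x, f x = 0 := fun x => by
      have := hneg x
      rw [← neg_eq_zero, ← this]
      exact Finset.sum_eq_zero fun i _ => by rw [congrFun h0 i]; simp
    obtain ⟨x, hx⟩ := hne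
    have h1 := hf _ coneUnit_mem
    have h2 := hu x hx
    rw [hf0] at h1 h2
    linarith
  · rw [hneg]; linarith [hw y hy]
  · rw [hneg]; linarith [hu x hx]

end Separation

/-! ### Real trace pairing and constraint slacks -/

/-- The real trace pairing of complex matrices. -/
def trIP {n : ℕ} :
    Matrix (Fin n) (Fin n) ℂ →ₗ[ℝ] Matrix (Fin n) (Fin n) ℂ →ₗ[ℝ] ℝ :=
  LinearMap.mk₂ ℝ (fun M W => (M * W).trace.re)
    (fun _ _ _ => by simp [Matrix.add_mul]) (fun _ _ _ => by simp)
    (fun _ _ _ => by simp [Matrix.mul_add]) (fun _ _ _ => by simp)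

theorem trIP_apply {n : ℕ} (M W : Matrix (Fin n) (Fin n) ℂ) :
    trIP M W = (M * W).trace.re := rfl

theorem trIP_vecMulVec_star {n : ℕ} (x : Fin n → ℂ) (W : Matrix (Fin n) (Fin n) ℂ) :
    trIP (vecMulVec x (star x)) W = (star x ⬝ᵥ W *ᵥ x).re := by
  rw [trIP_apply, trace_vecMulVec_star_mul]

theorem trIP_one {n : ℕ} (W : Matrix (Fin n) (Fin n) ℂ) : trIP 1 W = W.trace.re := by
  rw [trIP_apply, Matrix.one_mul]

/-- The Hermitian matrix which pairs with Hermitian `R` to the real part of `aᴴ R d`. -/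
def crossRe {n : ℕ} (a d : Fin n → ℂ) : Matrix (Fin n) (Fin n) ℂ :=
  (1 / 2 : ℝ) • (vecMulVec d (star a) + vecMulVec a (star d))

/-- The Hermitian matrix which pairs with Hermitian `R` to the imaginary part of `aᴴ R d`. -/
def crossIm {n : ℕ} (a d : Fin n → ℂ) : Matrix (Fin n) (Fin n) ℂ :=
  (Complex.I / 2) • (vecMulVec a (star d) - vecMulVec d (star a))

theorem isHermitian_crossRe {n : ℕ} (a d : Fin n → ℂ) : (crossRe a d).IsHermitian := by
  simp [crossRe, IsHermitian, conjTranspose_smul, conjTranspose_vecMulVec, add_comm]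

theorem isHermitian_crossIm {n : ℕ} (a d : Fin n → ℂ) : (crossIm a d).IsHermitian := by
  have h : star (Complex.I / 2) = -(Complex.I / 2) := by
    apply Complex.ext <;> norm_num
  simp only [crossIm, IsHermitian, conjTranspose_smul, conjTranspose_vecMulVec,
    conjTranspose_sub, star_star, h]
  rw [neg_smul, ← smul_neg, neg_sub]

theorem trIP_crossRe {n : ℕ} (a d : Fin n → ℂ) {R : Matrix (Fin n) (Fin n) ℂ}
    (hR : R.IsHermitian) : trIP (crossRe a d) R = (star a ⬝ᵥ R *ᵥ d).re := by
  rw [trIP_apply, crossRe, Matrix.smul_mul, Matrix.add_mul, trace_smul, trace_add,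
    trace_vecMulVec_mul, trace_vecMulVec_mul, star_form hR a d]
  simp
  ring

theorem trIP_crossIm {n : ℕ} (a d : Fin n → ℂ) {R : Matrix (Fin n) (Fin n) ℂ}
    (hR : R.IsHermitian) : trIP (crossIm a d) R = (star a ⬝ᵥ R *ᵥ d).im := by
  rw [trIP_apply, crossIm, Matrix.smul_mul, Matrix.sub_mul, trace_smul, trace_sub,
    trace_vecMulVec_mul, trace_vecMulVec_mul, star_form hR a d]
  simp
  ring

/-- `e a aᴴ + c d dᴴ`, which pairs with `R` to the first diagonal entry of `crbMat` at `t = 0`. -/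
def radarMat {n : ℕ} (a d : Fin n → ℂ) (c e : ℝ) : Matrix (Fin n) (Fin n) ℂ :=
  e • vecMulVec a (star a) + c • vecMulVec d (star d)

/-- The slacks of the constraints of the relaxation, together with the increase of the objective
over `t₀`. -/
def slack {K Nt : ℕ} (a d : Fin Nt → ℂ) (c e : ℝ) (H : Matrix (Fin K) (Fin Nt) ℂ)
    (Γ : Fin K → ℝ) (σC PT t₀ : ℝ) (W : Fin K → Matrix (Fin Nt) (Fin Nt) ℂ) (t : ℝ) :
    Fin K ⊕ Fin 6 → ℝ :=
  Sum.elim (fun k => (1 + Γ k) * trIP (channelGram H k) (W k) -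
      Γ k * trIP (channelGram H k) (∑ i, W i) - Γ k * σC ^ 2)
    ![t - t₀, PT - trIP 1 (∑ i, W i), trIP (radarMat a d c e) (∑ i, W i) - t,
      c * trIP (vecMulVec a (star a)) (∑ i, W i), c * trIP (crossRe a d) (∑ i, W i),
      c * trIP (crossIm a d) (∑ i, W i)]

theorem crbMat_posSemidef_iff {Nr Nt : ℕ} {θ : ℝ} {R : Matrix (Fin Nt) (Fin Nt) ℂ} {t c e : ℝ}
    (hc : star (steering Nr θ) ⬝ᵥ steering Nr θ = c)
    (he : star (steeringDot Nr θ) ⬝ᵥ steeringDot Nr θ = e) (hR : R.PosSemidef) :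
    (crbMat Nr θ R t).PosSemidef ↔
      0 ≤ trIP (radarMat (steering Nt θ) (steeringDot Nt θ) c e) R - t ∧
      0 ≤ c * trIP (vecMulVec (steering Nt θ) (star (steering Nt θ))) R ∧
      (c * trIP (crossRe (steering Nt θ) (steeringDot Nt θ)) R) ^ 2 +
        (c * trIP (crossIm (steering Nt θ) (steeringDot Nt θ)) R) ^ 2 ≤
      (trIP (radarMat (steering Nt θ) (steeringDot Nt θ) c e) R - t) *
        (c * trIP (vecMulVec (steering Nt θ) (star (steering Nt θ))) R) := by
  have hre : ∀ u : Fin Nt → ℂ, star u ⬝ᵥ R *ᵥ u = ((star u ⬝ᵥ R *ᵥ u).re : ℂ) := fun u =>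
    Complex.ext rfl (by simpa using (Complex.nonneg_iff.1 (hR.dotProduct_mulVec_nonneg u)).2.symm)
  rw [crbMat_eq Nr θ R t hc he, trIP_crossRe _ _ hR.1, trIP_crossIm _ _ hR.1, radarMat, map_add,
    LinearMap.add_apply, map_smul, map_smul, LinearMap.smul_apply, LinearMap.smul_apply,
    trIP_vecMulVec_star, trIP_vecMulVec_star, star_form hR.1 (steering Nt θ) (steeringDot Nt θ)]
  generalize star (steering Nt θ) ⬝ᵥ R *ᵥ steeringDot Nt θ = z
  rw [hre (steering Nt θ), hre (steeringDot Nt θ)]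
  generalize (star (steering Nt θ) ⬝ᵥ R *ᵥ steering Nt θ).re = p
  generalize (star (steeringDot Nt θ) ⬝ᵥ R *ᵥ steeringDot Nt θ).re = q
  have := posSemidef_fin_two (p := e * p + c * q - t) (q := c * p) (z := c * z)
  simp only [star_mul', Complex.star_def, Complex.conj_ofReal, Complex.re_ofReal_mul,
    Complex.im_ofReal_mul] at this
  push_cast at this
  simpa using this

theorem slack_mem_weakCone_iff {K Nt Nr : ℕ} {θ : ℝ} {H : Matrix (Fin K) (Fin Nt) ℂ}
    {Γ : Fin K → ℝ} {σC PT t₀ t c e : ℝ} {W : Fin K → Matrix (Fin Nt) (Fin Nt) ℂ}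
    (hc : star (steering Nr θ) ⬝ᵥ steering Nr θ = c)
    (he : star (steeringDot Nr θ) ⬝ᵥ steeringDot Nr θ = e) (hW : ∀ k, (W k).PosSemidef) :
    slack (steering Nt θ) (steeringDot Nt θ) c e H Γ σC PT t₀ W t ∈ weakCone (Fin K) ↔
      SDRFeasible Nr θ H Γ σC PT W t ∧ t₀ ≤ t := by
  have hR : (∑ k, W k).PosSemidef := posSemidef_sum _ fun k _ => hW k
  have hs : ∀ k, (Γ k * σC ^ 2 ≤ (channelGram H k * W k).trace.re -
      Γ k * ∑ i ∈ Finset.univ.erase k, (channelGram H k * W i).trace.re) ↔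
      0 ≤ (1 + Γ k) * trIP (channelGram H k) (W k) -
      Γ k * trIP (channelGram H k) (∑ i, W i) - Γ k * σC ^ 2 := by
    intro k
    -- Adding user `k` to its own interference sum expresses the constraint through `W k` and the
    -- total covariance alone.
    rw [map_sum, ← Finset.add_sum_erase _ _ (Finset.mem_univ k), ← sub_nonneg]
    simp only [trIP_apply]
    constructor <;> intro h <;> linarith
  have hp : ∑ k, (W k).trace.re ≤ PT ↔ 0 ≤ PT - trIP 1 (∑ i, W i) := by
    simp [trIP_one]
  have hcrb := crbMat_posSemidef_iff (t := t) hc he hR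
  constructor
  · rintro ⟨h, h0, h1, h2, h3, h4⟩
    exact ⟨⟨hcrb.2 ⟨h2, h3, h4⟩, fun k => (hs k).2 (h k), hp.2 h1, hW⟩, sub_nonneg.1 h0⟩
  · rintro ⟨h, h0⟩
    obtain ⟨h2, h3, h4⟩ := hcrb.1 h.crb
    exact ⟨fun k => (hs k).1 (h.sinr k), sub_nonneg.2 h0, hp.1 h.power, h2, h3, h4⟩

/-- The slacks are affine in the variables, so the attainable slack vectors form a convex set. -/
theorem slack_combo {K Nt : ℕ} (a d : Fin Nt → ℂ) (c e : ℝ) (H : Matrix (Fin K) (Fin Nt) ℂ)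
    (Γ : Fin K → ℝ) (σC PT t₀ : ℝ) (W W' : Fin K → Matrix (Fin Nt) (Fin Nt) ℂ) (t t' : ℝ)
    {x y : ℝ} (hxy : x + y = 1) :
    slack a d c e H Γ σC PT t₀ (x • W + y • W') (x * t + y * t') =
      x • slack a d c e H Γ σC PT t₀ W t + y • slack a d c e H Γ σC PT t₀ W' t' := by
  have hS : ∑ i, (x • W + y • W') i = x • (∑ i, W i) + y • ∑ i, W' i := by
    simp [Finset.sum_add_distrib, Finset.smul_sum]
  ext (k | i)
  · simp only [slack, hS]
    simp only [Sum.elim_inl, Pi.add_apply, Pi.smul_apply, map_add, map_smul,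
      smul_eq_mul]
    linear_combination (Γ k * σC ^ 2) * hxy
  · simp only [slack, hS]
    simp only [Sum.elim_inr, Pi.add_apply, Pi.smul_apply, map_add, map_smul,
      smul_eq_mul]
    fin_cases i <;> simp [-map_sum]
    · linear_combination t₀ * hxy
    · linear_combination -PT * hxy
    all_goals ring

/-! ### Dual matrices and Fritz John multipliers -/

/-- The dual matrix common to all users: `μ I - F + ∑ l_i Γ_i Q_i`, where `F` is the weight of the
Cramér–Rao constraint with multipliers `z, w, x, y`. -/
def dualBase {K Nt : ℕ} (a d : Fin Nt → ℂ) (c e : ℝ) (H : Matrix (Fin K) (Fin Nt) ℂ)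
    (Γ l : Fin K → ℝ) (μ z w x y : ℝ) : Matrix (Fin Nt) (Fin Nt) ℂ :=
  μ • (1 : Matrix (Fin Nt) (Fin Nt) ℂ) - (z • radarMat a d c e + (w * c) • vecMulVec a (star a) +
    (x * c) • crossRe a d + (y * c) • crossIm a d) + ∑ i, (l i * Γ i) • channelGram H i

/-- The dual slack matrix of user `k`. -/
def dualSlack {K Nt : ℕ} (a d : Fin Nt → ℂ) (c e : ℝ) (H : Matrix (Fin K) (Fin Nt) ℂ)
    (Γ l : Fin K → ℝ) (μ z w x y : ℝ) (k : Fin K) : Matrix (Fin Nt) (Fin Nt) ℂ :=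
  dualBase a d c e H Γ l μ z w x y - (l k * (1 + Γ k)) • channelGram H k

theorem isHermitian_channelGram {K Nt : ℕ} (H : Matrix (Fin K) (Fin Nt) ℂ) (k : Fin K) :
    (channelGram H k).IsHermitian :=
  (posSemidef_vecMulVec_self_star _).1

theorem isHermitian_real_smul {n : ℕ} {M : Matrix (Fin n) (Fin n) ℂ} (hM : M.IsHermitian) (r : ℝ) :
    (r • M).IsHermitian := by
  rw [IsHermitian, conjTranspose_smul, hM.eq, star_trivial]

theorem isHermitian_dualBase {K Nt : ℕ} (a d : Fin Nt → ℂ) (c e : ℝ)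
    (H : Matrix (Fin K) (Fin Nt) ℂ) (Γ l : Fin K → ℝ) (μ z w x y : ℝ) :
    (dualBase a d c e H Γ l μ z w x y).IsHermitian := by
  have hv : ∀ u : Fin Nt → ℂ, (vecMulVec u (star u)).IsHermitian := fun u =>
    (posSemidef_vecMulVec_self_star u).1
  refine ((isHermitian_real_smul isHermitian_one _).sub ((((isHermitian_real_smul
    ((isHermitian_real_smul (hv a) _).add (isHermitian_real_smul (hv d) _)) _).add
    (isHermitian_real_smul (hv a) _)).add (isHermitian_real_smul (isHermitian_crossRe a d) _)).add
    (isHermitian_real_smul (isHermitian_crossIm a d) _))).add ?_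
  rw [IsHermitian, conjTranspose_sum]
  exact Finset.sum_congr rfl fun i _ => isHermitian_real_smul (isHermitian_channelGram H i) _

theorem isHermitian_dualSlack {K Nt : ℕ} (a d : Fin Nt → ℂ) (c e : ℝ)
    (H : Matrix (Fin K) (Fin Nt) ℂ) (Γ l : Fin K → ℝ) (μ z w x y : ℝ) (k : Fin K) :
    (dualSlack a d c e H Γ l μ z w x y k).IsHermitian :=
  (isHermitian_dualBase a d c e H Γ l μ z w x y).sub
    (isHermitian_real_smul (isHermitian_channelGram H k) _)

/-- Collecting the Lagrangian by primal variable: the coefficient of `W k` is minus its dual slack,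
and that of `t` must vanish because `t` is free. -/
theorem lagrangian_eq {K Nt : ℕ} (a d : Fin Nt → ℂ) (c e : ℝ) (H : Matrix (Fin K) (Fin Nt) ℂ)
    (Γ : Fin K → ℝ) (σC PT t₀ : ℝ) (W : Fin K → Matrix (Fin Nt) (Fin Nt) ℂ) (t : ℝ)
    (f : Fin K ⊕ Fin 6 → ℝ) :
    ∑ i, f i * slack a d c e H Γ σC PT t₀ W t i =
      (f (.inr 0) - f (.inr 2)) * t - f (.inr 0) * t₀ + f (.inr 1) * PT -
        ∑ k, f (.inl k) * (Γ k * σC ^ 2) -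
        ∑ k, trIP (dualSlack a d c e H Γ (fun k => f (.inl k)) (f (.inr 1)) (f (.inr 2))
          (f (.inr 3)) (f (.inr 4)) (f (.inr 5)) k) (W k) := by
  have h1 : ∑ k, trIP (dualSlack a d c e H Γ (fun k => f (.inl k)) (f (.inr 1)) (f (.inr 2))
      (f (.inr 3)) (f (.inr 4)) (f (.inr 5)) k) (W k) =
      trIP (dualBase a d c e H Γ (fun k => f (.inl k)) (f (.inr 1)) (f (.inr 2))
      (f (.inr 3)) (f (.inr 4)) (f (.inr 5))) (∑ k, W k) -
      ∑ k, f (.inl k) * (1 + Γ k) * trIP (channelGram H k) (W k) := by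
    rw [map_sum, ← Finset.sum_sub_distrib]
    exact Finset.sum_congr rfl fun k _ => by simp [dualSlack]
  have h2 : trIP (dualBase a d c e H Γ (fun k => f (.inl k)) (f (.inr 1)) (f (.inr 2))
      (f (.inr 3)) (f (.inr 4)) (f (.inr 5))) (∑ k, W k) =
      f (.inr 1) * trIP 1 (∑ k, W k) - (f (.inr 2) * trIP (radarMat a d c e) (∑ k, W k) +
      f (.inr 3) * c * trIP (vecMulVec a (star a)) (∑ k, W k) +
      f (.inr 4) * c * trIP (crossRe a d) (∑ k, W k) +
      f (.inr 5) * c * trIP (crossIm a d) (∑ k, W k)) +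
      ∑ k, f (.inl k) * Γ k * trIP (channelGram H k) (∑ k, W k) := by
    generalize ∑ k, W k = R
    rw [dualBase, map_add, map_sub, map_sum]
    simp only [map_add, map_smul, LinearMap.add_apply, LinearMap.sub_apply, LinearMap.smul_apply,
      LinearMap.sum_apply, smul_eq_mul]
  have h3 : ∑ k, f (.inl k) * ((1 + Γ k) * trIP (channelGram H k) (W k) -
      Γ k * trIP (channelGram H k) (∑ i, W i) - Γ k * σC ^ 2) =
      ∑ k, f (.inl k) * (1 + Γ k) * trIP (channelGram H k) (W k) -
      ∑ k, f (.inl k) * Γ k * trIP (channelGram H k) (∑ k, W k) -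
      ∑ k, f (.inl k) * (Γ k * σC ^ 2) := by
    rw [← Finset.sum_sub_distrib, ← Finset.sum_sub_distrib]
    exact Finset.sum_congr rfl fun k _ => by ring
  rw [h1, h2, Fintype.sum_sum_type, Fin.sum_univ_six]
  simp only [slack, Sum.elim_inl, Sum.elim_inr]
  rw [h3]
  simp
  ring

/-- Fritz John multipliers for an optimal solution of the relaxation. -/
theorem exists_multipliers {K Nt Nr : ℕ} {θ : ℝ} {H : Matrix (Fin K) (Fin Nt) ℂ}
    {Γ : Fin K → ℝ} {σC PT t c e : ℝ} {W : Fin K → Matrix (Fin Nt) (Fin Nt) ℂ}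
    (hc : star (steering Nr θ) ⬝ᵥ steering Nr θ = c)
    (he : star (steeringDot Nr θ) ⬝ᵥ steeringDot Nr θ = e)
    (hopt : SDROptimal Nr θ H Γ σC PT W t) :
    ∃ (l : Fin K → ℝ) (μ z w x y : ℝ), (∀ k, 0 ≤ l k) ∧ 0 ≤ μ ∧ 0 ≤ z ∧ 0 ≤ w ∧
      (z = 0 → w = 0 → x = 0 ∧ y = 0) ∧
      ¬ ((∀ k, l k = 0) ∧ μ = 0 ∧ z = 0 ∧ w = 0) ∧
      μ * PT = z * t + ∑ k, l k * (Γ k * σC ^ 2) ∧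
      ∀ k, (dualSlack (steering Nt θ) (steeringDot Nt θ) c e H Γ l μ z w x y k).PosSemidef ∧
        dualSlack (steering Nt θ) (steeringDot Nt θ) c e H Γ l μ z w x y k * W k = 0 := by
  set a := steering Nt θ
  set d := steeringDot Nt θ
  have hW := hopt.1.psd
  let g := slack a d c e H Γ σC PT t
  let C : Set (Fin K ⊕ Fin 6 → ℝ) := {u | ∃ W' t', (∀ k, (W' k).PosSemidef) ∧ g W' t' = u}
  have hC : Convex ℝ C := by
    rintro _ ⟨W₁, t₁, h₁, rfl⟩ _ ⟨W₂, t₂, h₂, rfl⟩ p q hp hq hpq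
    exact ⟨p • W₁ + q • W₂, p * t₁ + q * t₂,
      fun k => ((h₁ k).smul hp).add ((h₂ k).smul hq), slack_combo _ _ _ _ _ _ _ _ _ _ _ _ _ hpq⟩
  -- Strictly positive slacks would include a strict increase of `t`.
  have hdisj : Disjoint (strictCone (Fin K)) C := by
    rw [Set.disjoint_left]
    rintro _ hu ⟨W', t', hW', rfl⟩
    have h1 := (slack_mem_weakCone_iff hc he hW').1 (weakCone_of_strictCone hu)
    have h2 : 0 < t' - t := hu.2.1
    linarith [hopt.2 W' t' h1.1]
  obtain ⟨f, hf0, hfw, hfC⟩ := exists_separating_functional hC ⟨g W t, W, t, hW, rfl⟩ hdisj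
  have hL : ∀ (W' : Fin K → Matrix (Fin Nt) (Fin Nt) ℂ) (t' : ℝ), (∀ k, (W' k).PosSemidef) →
      (f (.inr 0) - f (.inr 2)) * t' - f (.inr 0) * t + f (.inr 1) * PT -
        ∑ k, f (.inl k) * (Γ k * σC ^ 2) -
        ∑ k, trIP (dualSlack a d c e H Γ (fun k => f (.inl k)) (f (.inr 1)) (f (.inr 2))
          (f (.inr 3)) (f (.inr 4)) (f (.inr 5)) k) (W' k) ≤ 0 := by
    intro W' t' hW'
    rw [← lagrangian_eq]
    exact hfC _ ⟨W', t', hW', rfl⟩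
  have hL0 := hfw _ ((slack_mem_weakCone_iff (H := H) (Γ := Γ) (σC := σC) (PT := PT)
    (t₀ := t) (t := t) hc he hW).2 ⟨hopt.1, le_rfl⟩)
  rw [lagrangian_eq] at hL0
  set M := dualSlack a d c e H Γ (fun k => f (.inl k)) (f (.inr 1)) (f (.inr 2))
          (f (.inr 3)) (f (.inr 4)) (f (.inr 5))
  have hpos : ∀ i, (Pi.single i 1 : Fin K ⊕ Fin 6 → ℝ) ∈ weakCone (Fin K) → 0 ≤ f i := by
    intro i hi
    simpa [Pi.single_apply] using hfw _ hi
  have hz : f (.inr 0) = f (.inr 2) := by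
    have h1 := hL W (t + 1) hW
    have h2 := hL W (t - 1) hW
    linarith
  simp only [hz, sub_self, zero_mul, zero_sub] at hL hL0
  -- The test points `0` and `2 • W`, compared with `W`, force both the constant term and the trace
  -- sum to vanish.
  have hconst : f (.inr 1) * PT = f (.inr 2) * t + ∑ k, f (.inl k) * (Γ k * σC ^ 2) := by
    have h1 := hL 0 0 fun _ => .zero
    have h2 := hL (2 • W) 0 fun k => by
      simpa [two_smul] using (hW k).add (hW k)
    simp [two_smul, Finset.sum_add_distrib] at h1 h2
    linarith
  have hM : ∀ k, (M k).PosSemidef := by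
    intro k
    refine PosSemidef.of_dotProduct_mulVec_nonneg (isHermitian_dualSlack _ _ _ _ _ _ _ _ _ _ _ _ _)
      fun x => ?_
    have h1 := hL (Pi.single k (vecMulVec x (star x))) 0 fun j => by
      rcases eq_or_ne j k with rfl | hj
      · simpa using posSemidef_vecMulVec_self_star x
      · simpa [hj] using PosSemidef.zero
    have h3 : ∑ j, trIP (M j) ((Pi.single k (vecMulVec x (star x)) :
        Fin K → Matrix (Fin Nt) (Fin Nt) ℂ) j) = (star x ⬝ᵥ M k *ᵥ x).re := by
      rw [Finset.sum_eq_single k (fun j _ hj => by simp [hj]) (by simp), Pi.single_eq_same,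
        trIP_apply, trace_mul_vecMulVec_star]
    rw [h3] at h1
    rw [Complex.nonneg_iff]
    refine ⟨by linarith, ?_⟩
    have h2 := star_form (isHermitian_dualSlack a d c e H Γ (fun k => f (.inl k)) (f (.inr 1))
      (f (.inr 2)) (f (.inr 3)) (f (.inr 4)) (f (.inr 5)) k) x x
    exact (Complex.conj_eq_iff_im.1 h2.symm).symm
  -- An element of the dual cone with zero diagonal has zero off-diagonal part: test it on
  -- unit-diagonal matrices with off-diagonal entries of both signs.
  have hcross : f (.inr 2) = 0 → f (.inr 3) = 0 → f (.inr 4) = 0 ∧ f (.inr 5) = 0 := by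
    intro h2 h3
    have h4 : ∀ p q : ℝ, p ^ 2 + q ^ 2 ≤ 1 → 0 ≤ f (.inr 4) * p + f (.inr 5) * q := by
      intro p q hpq
      have h := hfw (Sum.elim 0 ![0, 0, 1, 1, p, q])
        ⟨fun k => by simp, by simp, by simp, by simp, by simp, by simpa using hpq⟩
      rw [Fintype.sum_sum_type, Fin.sum_univ_six] at h
      simpa [h2, h3] using h
    constructor
    · linarith [h4 1 0 (by norm_num), h4 (-1) 0 (by norm_num)]
    · linarith [h4 0 1 (by norm_num), h4 0 (-1) (by norm_num)]
  refine ⟨fun k => f (.inl k), f (.inr 1), f (.inr 2), f (.inr 3), f (.inr 4), f (.inr 5),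
    fun k => hpos _ ?_, hpos _ ?_, hpos _ ?_, hpos _ ?_, ?_, ?_, hconst, fun k => ⟨hM k, ?_⟩⟩
  · refine ⟨fun j => ?_, ?_⟩ <;> simp [Pi.single_apply]
    split_ifs <;> norm_num
  · refine ⟨fun j => ?_, ?_⟩ <;> simp
  · refine ⟨fun j => ?_, ?_⟩ <;> simp
  · refine ⟨fun j => ?_, ?_⟩ <;> simp
  · exact hcross
  · rintro ⟨h, h1, h2, h3⟩
    refine hf0 (funext fun i => ?_)
    rcases i with k | i
    · exact h k
    · fin_cases i
      · exact hz.trans h2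
      · exact h1
      · exact h2
      · exact h3
      · exact (hcross h2 h3).1
      · exact (hcross h2 h3).2
  · refine mul_eq_zero_of_trace_re_eq_zero (hM k) (hW k) ?_
    have h1 : ∀ i ∈ Finset.univ, 0 ≤ trIP (M i) (W i) := fun i _ =>
      trace_mul_re_nonneg (hM i) (hW i)
    exact (Finset.sum_eq_zero_iff_of_nonneg h1).1
      (le_antisymm (by linarith) (Finset.sum_nonneg h1)) k (Finset.mem_univ k)

/-! ### The kernel of the common dual matrix -/

/-- The action of the weight of the Cramér–Rao constraint, which has range in `span {a, d}`. -/
theorem weight_mulVec {n : ℕ} (a d u : Fin n → ℂ) (c e z w x y : ℝ) :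
    (z • radarMat a d c e + (w * c) • vecMulVec a (star a) +
      (x * c) • crossRe a d + (y * c) • crossIm a d) *ᵥ u =
    (((z * e + w * c : ℝ) : ℂ) * (star a ⬝ᵥ u) +
        (c / 2 : ℝ) * (x + Complex.I * y) * (star d ⬝ᵥ u)) • a +
      (((z * c : ℝ) : ℂ) * (star d ⬝ᵥ u) +
        (c / 2 : ℝ) * (x - Complex.I * y) * (star a ⬝ᵥ u)) • d := by
  simp only [radarMat, crossRe, crossIm, add_mulVec, sub_mulVec, smul_mulVec, vecMulVec_mulVec,
    smul_add, smul_sub]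
  ext i
  simp only [Pi.add_apply, Pi.sub_apply, Pi.smul_apply, MulOpposite.smul_eq_mul_unop,
    MulOpposite.unop_op, smul_eq_mul, Complex.real_smul]
  push_cast
  ring

/-- An eigenspace of the weight for a positive eigenvalue is at most one-dimensional. -/
theorem exists_span_of_weight_eigen {n : ℕ} {a d : Fin n → ℂ} {c e z w x y μ na nd : ℝ}
    (hna : star a ⬝ᵥ a = na) (hnd : star d ⬝ᵥ d = nd) (had : star a ⬝ᵥ d = 0)
    (hna0 : 0 < na) (hnd0 : 0 < nd) (hc : 0 < c) (hz : 0 ≤ z) (hw : 0 ≤ w) (hμ : 0 < μ)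
    (hlt : c * nd < e * na) :
    ∃ v ∈ Submodule.span ℂ {a, d}, ∀ u,
      (z • radarMat a d c e + (w * c) • vecMulVec a (star a) +
        (x * c) • crossRe a d + (y * c) • crossIm a d) *ᵥ u = μ • u → ∃ r : ℂ, u = r • v := by
  have hda : star d ⬝ᵥ a = 0 := by rw [star_dotProduct, had, star_zero]
  have hnaC : (na : ℂ) ≠ 0 := by exact_mod_cast hna0.ne'
  have hndC : (nd : ℂ) ≠ 0 := by exact_mod_cast hnd0.ne'
  have hμC : (μ : ℂ) ≠ 0 := by exact_mod_cast hμ.ne'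
  obtain ⟨g, hg⟩ : ∃ g : ℂ, g = (c / 2 : ℝ) * (x + Complex.I * y) := ⟨_, rfl⟩
  obtain ⟨g', hg'⟩ : ∃ g' : ℂ, g' = (c / 2 : ℝ) * (x - Complex.I * y) := ⟨_, rfl⟩
  have hmem : ∀ r s : ℂ, r • a + s • d ∈ Submodule.span ℂ {a, d} := fun r s =>
    Submodule.mem_span_pair.2 ⟨r, s, rfl⟩
  -- In the orthogonal basis `a, d` the eigenvalue equation is a two by two system; since `μ ≠ 0`,
  -- the eigenvector lies in the span.
  have hsys : ∀ u, (z • radarMat a d c e + (w * c) • vecMulVec a (star a) +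
      (x * c) • crossRe a d + (y * c) • crossIm a d) *ᵥ u = μ • u →
      (((z * e + w * c) * na - μ : ℝ) : ℂ) * (star a ⬝ᵥ u) + g * na * (star d ⬝ᵥ u) = 0 ∧
      ((z * c * nd - μ : ℝ) : ℂ) * (star d ⬝ᵥ u) + g' * nd * (star a ⬝ᵥ u) = 0 ∧
      u = ((star a ⬝ᵥ u) / na) • a + ((star d ⬝ᵥ u) / nd) • d := by
    intro u hu
    rw [weight_mulVec, ← hg, ← hg'] at hu
    have ha := congrArg (star a ⬝ᵥ ·) hu
    have hd := congrArg (star d ⬝ᵥ ·) hu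
    simp only [dotProduct_add, dotProduct_smul, hna, hnd, had, hda, smul_eq_mul, mul_zero, add_zero,
      zero_add, Complex.real_smul] at ha hd
    refine ⟨by push_cast at ha ⊢; linear_combination ha,
      by push_cast at hd ⊢; linear_combination hd, ?_⟩
    have h1 : (star a ⬝ᵥ u) / na = (((z * e + w * c : ℝ) : ℂ) * (star a ⬝ᵥ u) +
        g * (star d ⬝ᵥ u)) / μ := by
      field_simp
      linear_combination -ha
    have h2 : (star d ⬝ᵥ u) / nd = (((z * c : ℝ) : ℂ) * (star d ⬝ᵥ u) +
        g' * (star a ⬝ᵥ u)) / μ := by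
      field_simp
      linear_combination -hd
    rw [h1, h2]
    ext i
    have h3 := congrFun hu i
    simp only [Pi.add_apply, Pi.smul_apply, smul_eq_mul, Complex.real_smul] at h3 ⊢
    field_simp
    linear_combination -h3
  by_cases hp : (z * e + w * c) * na - μ = 0
  -- Both diagonal entries cannot equal `μ`: that would give `z * e * na ≤ z * c * nd` with `z > 0`,
  -- against `hlt`.
  · have hq : ((z * c * nd - μ : ℝ) : ℂ) ≠ 0 := by
      intro hq
      have hq : z * c * nd - μ = 0 := by exact_mod_cast hq
      have hz0 : 0 < z := by
        rcases hz.eq_or_lt with rfl | h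
        · linarith
        · exact h
      nlinarith [mul_lt_mul_of_pos_left hlt hz0, mul_nonneg (mul_nonneg hw hc.le) hna0.le]
    refine ⟨(1 / na : ℂ) • a + (-(g' * nd / (z * c * nd - μ : ℝ)) / nd : ℂ) • d, hmem _ _,
      fun u hu => ⟨star a ⬝ᵥ u, ?_⟩⟩
    obtain ⟨-, h2, h3⟩ := hsys u hu
    have h4 : star d ⬝ᵥ u = -(g' * nd / (z * c * nd - μ : ℝ)) * (star a ⬝ᵥ u) := by
      field_simp
      linear_combination h2
    rw [h4] at h3
    refine h3.trans ?_
    rw [smul_add, smul_smul, smul_smul]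
    congr 2 <;> ring
  · have hp : (((z * e + w * c) * na - μ : ℝ) : ℂ) ≠ 0 := by exact_mod_cast hp
    refine ⟨(-(g * na / ((z * e + w * c) * na - μ : ℝ)) / na : ℂ) • a + (1 / nd : ℂ) • d, hmem _ _,
      fun u hu => ⟨star d ⬝ᵥ u, ?_⟩⟩
    obtain ⟨h1, -, h3⟩ := hsys u hu
    have h4 : star a ⬝ᵥ u = -(g * na / ((z * e + w * c) * na - μ : ℝ)) * (star d ⬝ᵥ u) := by
      field_simp
      linear_combination h1
    rw [h4] at h3
    refine h3.trans ?_
    rw [smul_add, smul_smul, smul_smul]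
    congr 2 <;> ring

theorem channelGram_mulVec {K Nt : ℕ} (H : Matrix (Fin K) (Fin Nt) ℂ) (k : Fin K)
    (u : Fin Nt → ℂ) :
    channelGram H k *ᵥ u = (star (channelVec H k) ⬝ᵥ u) • channelVec H k := by
  rw [channelGram, vecMulVec_mulVec]
  ext i
  simp [mul_comm]

theorem dualBase_mulVec {K Nt : ℕ} (a d : Fin Nt → ℂ) (c e : ℝ) (H : Matrix (Fin K) (Fin Nt) ℂ)
    (Γ l : Fin K → ℝ) (μ z w x y : ℝ) (u : Fin Nt → ℂ) :
    dualBase a d c e H Γ l μ z w x y *ᵥ u = μ • u -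
      (z • radarMat a d c e + (w * c) • vecMulVec a (star a) +
        (x * c) • crossRe a d + (y * c) • crossIm a d) *ᵥ u +
      ∑ i, (l i * Γ i) • ((star (channelVec H i) ⬝ᵥ u) • channelVec H i) := by
  rw [dualBase, add_mulVec, sub_mulVec, smul_mulVec, one_mulVec, sum_mulVec]
  simp_rw [smul_mulVec, channelGram_mulVec]

/-- A null vector of the common dual matrix is orthogonal to the channels with a positive
multiplier. -/
theorem multiplier_mul_eq_zero {K Nt : ℕ} {a d : Fin Nt → ℂ} {c e : ℝ}
    {H : Matrix (Fin K) (Fin Nt) ℂ} {Γ l : Fin K → ℝ} {μ z w x y : ℝ} {k : Fin K}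
    (hΓ : 0 < Γ k) (hl : 0 ≤ l k)
    (hM : (dualSlack a d c e H Γ l μ z w x y k).PosSemidef) {u : Fin Nt → ℂ}
    (hu : dualBase a d c e H Γ l μ z w x y *ᵥ u = 0) :
    l k = 0 ∨ star (channelVec H k) ⬝ᵥ u = 0 := by
  -- On a null vector of the base the form of the dual slack is `-l k * (1 + Γ k) * |h_kᴴ u|²`.
  have h := (Complex.nonneg_iff.1 (hM.dotProduct_mulVec_nonneg u)).1
  rw [dualSlack, sub_mulVec, hu, smul_mulVec, channelGram_mulVec, zero_sub, dotProduct_neg,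
    dotProduct_smul, dotProduct_smul, star_dotProduct u, smul_eq_mul, Complex.star_def,
    Complex.mul_conj, Complex.neg_re, Complex.real_smul, ← Complex.ofReal_mul,
    Complex.ofReal_re] at h
  by_contra! hcon
  have h1 : 0 < l k := lt_of_le_of_ne hl (Ne.symm hcon.1)
  have h2 := Complex.normSq_pos.2 hcon.2
  have : 0 < l k * (1 + Γ k) * Complex.normSq (star (channelVec H k) ⬝ᵥ u) := by positivity
  linarith

theorem star_channelVec_dotProduct {K Nt : ℕ} (H : Matrix (Fin K) (Fin Nt) ℂ) (k : Fin K)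
    (v : Fin Nt → ℂ) : star (channelVec H k) ⬝ᵥ v = (H *ᵥ v) k := by
  rw [channelVec, star_star]
  rfl

theorem mulVec_ne_zero_of_rank {K Nt : ℕ} {H : Matrix (Fin K) (Fin Nt) ℂ} {θ : ℝ}
    (hrank : (H * steeringPair Nt θ).rank = 2) {α β : ℂ} (h : α ≠ 0 ∨ β ≠ 0) :
    H *ᵥ (α • steering Nt θ + β • steeringDot Nt θ) ≠ 0 := by
  intro h0
  have h1 : (H * steeringPair Nt θ).mulVecLin ![α, β] = 0 := by
    rw [mulVecLin_apply, ← mulVec_mulVec]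
    have h2 : steeringPair Nt θ *ᵥ ![α, β] = α • steering Nt θ + β • steeringDot Nt θ := by
      ext i
      simp [steeringPair, mulVec, dotProduct, Fin.sum_univ_two, mul_comm]
    rw [h2, h0]
  have h2 := (H * steeringPair Nt θ).mulVecLin.finrank_range_add_finrank_ker
  rw [← Matrix.rank, hrank, Module.finrank_fin_fun, Nat.add_eq_left,
    Submodule.finrank_eq_zero] at h2
  have h3 : ![α, β] ∈ LinearMap.ker (H * steeringPair Nt θ).mulVecLin := h1
  rw [h2, Submodule.mem_bot] at h3
  rcases h with h | h
  · exact h (congrFun h3 0)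
  · exact h (congrFun h3 1)

theorem exists_channel_ne_zero {K Nt : ℕ} {H : Matrix (Fin K) (Fin Nt) ℂ} {θ : ℝ}
    (hrank : (H * steeringPair Nt θ).rank = 2) {v : Fin Nt → ℂ}
    (hv : v ∈ Submodule.span ℂ {steering Nt θ, steeringDot Nt θ}) (hv0 : v ≠ 0) :
    ∃ k, star (channelVec H k) ⬝ᵥ v ≠ 0 := by
  obtain ⟨α, β, rfl⟩ := Submodule.mem_span_pair.1 hv
  have h : α ≠ 0 ∨ β ≠ 0 := by
    by_contra! h
    simp [h.1, h.2] at hv0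
  obtain ⟨k, hk⟩ := Function.ne_iff.1 (mulVec_ne_zero_of_rank hrank h)
  exact ⟨k, by rwa [star_channelVec_dotProduct]⟩

theorem steering_ne_zero {N : ℕ} (hN : 0 < N) (θ : ℝ) : steering N θ ≠ 0 := fun h =>
  Complex.exp_ne_zero _ (congrFun h ⟨0, hN⟩)

/-- The norms of the steering vectors and of their derivatives, and the strict inequality between
them when the receive array is larger than the transmit array. -/
theorem exists_steering_constants {K Nt Nr : ℕ} (hN : Nt < Nr) {θ : ℝ}
    {H : Matrix (Fin K) (Fin Nt) ℂ} (hrank : (H * steeringPair Nt θ).rank = 2) :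
    ∃ c e na nd : ℝ, star (steering Nr θ) ⬝ᵥ steering Nr θ = c ∧
      star (steeringDot Nr θ) ⬝ᵥ steeringDot Nr θ = e ∧
      star (steering Nt θ) ⬝ᵥ steering Nt θ = na ∧
      star (steeringDot Nt θ) ⬝ᵥ steeringDot Nt θ = nd ∧
      0 < c ∧ 0 < e ∧ 0 < na ∧ 0 < nd ∧ c * nd < e * na := by
  refine ⟨_, _, _, _, star_steering_dotProduct_steering Nr θ,
    star_steeringDot_dotProduct_steeringDot Nr θ, star_steering_dotProduct_steering Nt θ,
    star_steeringDot_dotProduct_steeringDot Nt θ, ?_⟩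
  -- The rank hypothesis excludes a vanishing derivative, and with it `cos θ = 0`.
  have hd : steeringDot Nt θ ≠ 0 := by
    intro h
    have := mulVec_ne_zero_of_rank hrank (α := 0) (β := 1) (.inr one_ne_zero)
    simp [h] at this
  have hpos : 0 < star (steeringDot Nt θ) ⬝ᵥ steeringDot Nt θ := dotProduct_star_self_pos_iff.2 hd
  rw [star_steeringDot_dotProduct_steeringDot, Complex.zero_lt_real] at hpos
  have hNt : 0 < Nt := by
    rcases Nat.eq_zero_or_pos Nt with rfl | h
    · simp at hpos
    · exact h
  have hNt' : (1 : ℝ) ≤ Nt := by exact_mod_cast hNt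
  have hNr : (Nt : ℝ) < Nr := by exact_mod_cast hN
  have hκ : 0 < (Real.pi * Real.cos θ) ^ 2 := by
    refine lt_of_le_of_ne (sq_nonneg _) fun h => ?_
    rw [← h, zero_mul] at hpos
    exact lt_irrefl _ hpos
  have hsq : (Nt : ℝ) ^ 2 < (Nr : ℝ) ^ 2 := by nlinarith
  have h1 : (1 : ℝ) ≤ (Nt : ℝ) ^ 2 := by nlinarith
  have hr0 : (0 : ℝ) < Nr := by linarith
  have hsub : (0 : ℝ) < (Nr : ℝ) ^ 2 - 1 := by linarith
  refine ⟨hr0, by positivity, by linarith, hpos, ?_⟩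
  -- With `κ = (π cos θ)²`, the gap `e * na - c * nd` equals `κ * Nr * Nt * (Nr² - Nt²) / 12`.
  have h2 : 0 < (Real.pi * Real.cos θ) ^ 2 * (Nr * Nt / 12) := by positivity
  nlinarith [mul_lt_mul_of_pos_left hsq h2]

/-! ### Structure of the optimal solutions -/

/-- At `t = 0` the Cramér–Rao inequality is automatic by Cauchy–Schwarz for the form of `R`.
Consequently an optimal `t` is nonnegative. -/
theorem sdrFeasible_zero {K Nt Nr : ℕ} {θ : ℝ} {H : Matrix (Fin K) (Fin Nt) ℂ}
    {Γ : Fin K → ℝ} {σC PT t c e : ℝ} {W : Fin K → Matrix (Fin Nt) (Fin Nt) ℂ}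
    (hc : star (steering Nr θ) ⬝ᵥ steering Nr θ = c)
    (he : star (steeringDot Nr θ) ⬝ᵥ steeringDot Nr θ = e) (hc0 : 0 < c) (he0 : 0 < e)
    (h : SDRFeasible Nr θ H Γ σC PT W t) : SDRFeasible Nr θ H Γ σC PT W 0 := by
  refine ⟨?_, h.sinr, h.power, h.psd⟩
  have hR : (∑ k, W k).PosSemidef := posSemidef_sum _ fun k _ => h.psd k
  rw [crbMat_posSemidef_iff hc he hR, trIP_crossRe _ _ hR.1, trIP_crossIm _ _ hR.1, radarMat,
    map_add, LinearMap.add_apply, map_smul, map_smul, LinearMap.smul_apply, LinearMap.smul_apply,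
    trIP_vecMulVec_star, trIP_vecMulVec_star, sub_zero, smul_eq_mul, smul_eq_mul]
  have h1 := norm_sq_form_le hR (steering Nt θ) (steeringDot Nt θ)
  have h2 := (Complex.nonneg_iff.1 (hR.dotProduct_mulVec_nonneg (steering Nt θ))).1
  have h3 := (Complex.nonneg_iff.1 (hR.dotProduct_mulVec_nonneg (steeringDot Nt θ))).1
  refine ⟨by positivity, by positivity, ?_⟩
  nlinarith [mul_le_mul_of_nonneg_left h1 (mul_pos hc0 hc0).le, mul_nonneg (mul_pos he0 hc0).le
    (mul_nonneg h2 h2)]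

theorem signal_pos {K Nt Nr : ℕ} {θ : ℝ} {H : Matrix (Fin K) (Fin Nt) ℂ}
    {Γ : Fin K → ℝ} {σC PT t : ℝ} {W : Fin K → Matrix (Fin Nt) (Fin Nt) ℂ}
    (hΓ : ∀ k, 0 < Γ k) (hσ : 0 < σC) (h : SDRFeasible Nr θ H Γ σC PT W t) (k : Fin K) :
    0 < (channelGram H k * W k).trace.re := by
  have h1 := h.sinr k
  have h2 : 0 ≤ ∑ i ∈ Finset.univ.erase k, (channelGram H k * W i).trace.re :=
    Finset.sum_nonneg fun i _ => trace_mul_re_nonneg (posSemidef_vecMulVec_self_star _) (h.psd i)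
  have h3 := mul_nonneg (hΓ k).le h2
  have h4 : 0 < Γ k * σC ^ 2 := mul_pos (hΓ k) (by positivity)
  linarith

/-- The structure of the optimal solutions of the relaxation. -/
theorem optimal_structure {K Nt Nr : ℕ} (hN : Nt < Nr) {θ : ℝ} {H : Matrix (Fin K) (Fin Nt) ℂ}
    {Γ : Fin K → ℝ} {σC PT t : ℝ} {W : Fin K → Matrix (Fin Nt) (Fin Nt) ℂ}
    (hΓ : ∀ k, 0 < Γ k) (hσ : 0 < σC)
    (hrank : (H * steeringPair Nt θ).rank = 2) (hopt : SDROptimal Nr θ H Γ σC PT W t) :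
    (∀ k, (W k).rank = 1) ∨
    ∃ v ∈ Submodule.span ℂ {steering Nt θ, steeringDot Nt θ}, v ≠ 0 ∧
      (∀ k, star (channelVec H k) ⬝ᵥ v ≠ 0 →
        ∃ r : ℝ, 0 ≤ r ∧ W k = (r : ℂ) • vecMulVec v (star v)) ∧
      ∀ k, ∃ (u : Fin Nt → ℂ) (r : ℝ), 0 ≤ r ∧
        W k = vecMulVec u (star u) + (r : ℂ) • vecMulVec v (star v) ∧
        trIP (channelGram H k) (vecMulVec u (star u)) = trIP (channelGram H k) (W k) := by
  obtain ⟨c, e, na, nd, hc, he, hna, hnd, hc0, he0, hna0, hnd0, hlt⟩ :=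
    exists_steering_constants hN hrank
  have had := star_steering_dotProduct_steeringDot Nt θ
  obtain ⟨l, μ, z, w, x, y, hl, hμ, hz, hw, hxy, hnt, hval, hM⟩ := exists_multipliers hc he hopt
  have hW := hopt.1.psd
  set a := steering Nt θ
  set d := steeringDot Nt θ
  have hNt : 0 < Nt := by
    by_contra h
    obtain rfl : Nt = 0 := by omega
    simp only [dotProduct_of_isEmpty] at hna
    exact hna0.ne (by exact_mod_cast hna)
  have ht : 0 ≤ t := by
    have := hopt.2 W 0 (sdrFeasible_zero hc he hc0 he0 hopt.1)
    linarith
  -- There is at least one user, hence at least one dual slack to test.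
  obtain ⟨k₀, -⟩ := exists_channel_ne_zero hrank (v := a)
    (Submodule.subset_span (by simp [a])) (steering_ne_zero hNt θ)
  -- If `μ = 0`, the value identity kills all `l k`; the dual slack is then minus the weight, and
  -- its value at `a` kills `z` and `w`, against nontriviality.
  have hμ0 : 0 < μ := by
    refine lt_of_le_of_ne hμ fun h0 => ?_
    have hterm : ∀ k ∈ Finset.univ, 0 ≤ l k * (Γ k * σC ^ 2) := fun k _ =>
      mul_nonneg (hl k) (mul_nonneg (hΓ k).le (sq_nonneg _))
    have hsum : ∑ k, l k * (Γ k * σC ^ 2) = 0 := by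
      rw [← h0, zero_mul] at hval
      exact le_antisymm (by linarith [mul_nonneg hz ht]) (Finset.sum_nonneg hterm)
    have hl0 : ∀ k, l k = 0 := fun k =>
      (mul_eq_zero.1 ((Finset.sum_eq_zero_iff_of_nonneg hterm).1 hsum k
        (Finset.mem_univ k))).resolve_right (mul_pos (hΓ k) (by positivity)).ne'
    have hform := (Complex.nonneg_iff.1 ((hM k₀).1.dotProduct_mulVec_nonneg a)).1
    have hda : star d ⬝ᵥ a = 0 := by rw [star_dotProduct, had, star_zero]
    rw [dualSlack, hl0 k₀, zero_mul, zero_smul, sub_zero, dualBase_mulVec, weight_mulVec, ← h0,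
      Finset.sum_eq_zero fun i _ => by rw [hl0 i, zero_mul, zero_smul], zero_smul, add_zero,
      zero_sub, dotProduct_neg, dotProduct_add, dotProduct_smul, dotProduct_smul, hna, had, hda,
      mul_zero, add_zero, smul_zero, add_zero, smul_eq_mul, ← Complex.ofReal_mul,
      ← Complex.ofReal_mul, Complex.neg_re, Complex.ofReal_re] at hform
    have h1 : z * e + w * c ≤ 0 := by
      by_contra! h
      have : 0 < (z * e + w * c) * na * na := by positivity
      linarith
    have hz0 : z = 0 := by
      by_contra h
      have := mul_pos (lt_of_le_of_ne hz (Ne.symm h)) he0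
      linarith [mul_nonneg hw hc0.le]
    have hw0 : w = 0 := by
      by_contra h
      have := mul_pos (lt_of_le_of_ne hw (Ne.symm h)) hc0
      linarith [mul_nonneg hz he0.le]
    exact hnt ⟨hl0, h0.symm, hz0, hw0⟩
  set B := dualBase a d c e H Γ l μ z w x y
  obtain ⟨v, hv, hker⟩ := exists_span_of_weight_eigen (x := x) (y := y) hna hnd had hna0 hnd0 hc0
    hz hw hμ0 hlt
  have hBker : ∀ u, B *ᵥ u = 0 → ∃ r : ℂ, u = r • v := by
    intro u hu
    refine hker u ?_
    have h1 : B *ᵥ u = _ := dualBase_mulVec a d c e H Γ l μ z w x y u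
    rw [hu, Finset.sum_eq_zero, add_zero] at h1
    · exact (sub_eq_zero.1 h1.symm).symm
    · intro i _
      rcases multiplier_mul_eq_zero (hΓ i) (hl i) (hM i).1 hu with h | h <;> simp [h]
  have hs : ∀ k, ∃ s : ℝ, 0 < s ∧
      star (channelVec H k) ⬝ᵥ W k *ᵥ channelVec H k = (s : ℂ) := by
    intro k
    refine ⟨_, signal_pos hΓ hσ hopt.1 k, ?_⟩
    rw [channelGram, trace_vecMulVec_star_mul]
    exact Complex.ext rfl
      (by simpa using (Complex.nonneg_iff.1 ((hW k).dotProduct_mulVec_nonneg _)).2.symm)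
  choose s hs0 hs using hs
  have hsC : ∀ k, (s k : ℂ) ≠ 0 := fun k => by exact_mod_cast (hs0 k).ne'
  let u : Fin K → Fin Nt → ℂ := fun k => ((Real.sqrt (s k))⁻¹ : ℝ) • (W k *ᵥ channelVec H k)
  have hu : ∀ k, vecMulVec (u k) (star (u k)) = (s k : ℂ)⁻¹ •
      vecMulVec (W k *ᵥ channelVec H k) (star (W k *ᵥ channelVec H k)) := by
    intro k
    simp only [u]
    rw [star_smul, smul_vecMulVec, vecMulVec_smul, smul_smul, star_trivial, ← mul_inv,
      Real.mul_self_sqrt (hs0 k).le]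
    ext i j
    simp
  let D : Fin K → Matrix (Fin Nt) (Fin Nt) ℂ := fun k => W k - vecMulVec (u k) (star (u k))
  have hD : ∀ k, (D k).PosSemidef := fun k => by
    simp only [D]
    rw [hu]
    exact posSemidef_sub_rankOne (hW k) (hs k) (hsC k)
  have hDh : ∀ k, D k *ᵥ channelVec H k = 0 := fun k => by
    simp only [D]
    rw [hu]
    exact sub_rankOne_mulVec (hW k) (hs k) (hsC k)
  have hMD : ∀ k, dualSlack a d c e H Γ l μ z w x y k * D k = 0 := by
    intro k
    simp only [D]
    rw [hu, Matrix.mul_sub, (hM k).2, Matrix.mul_smul, mul_vecMulVec, mulVec_mulVec, (hM k).2]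
    simp
  have hQD : ∀ k, channelGram H k * D k = 0 := by
    intro k
    have h1 : star (channelVec H k) ᵥ* D k = 0 := by
      rw [← star_star (star (channelVec H k) ᵥ* D k), star_vecMul, star_star, (hD k).1.eq, hDh,
        star_zero]
    rw [channelGram, vecMulVec_mul, h1, vecMulVec_zero]
  -- The dual slack and the base differ by a multiple of `Q_k`, which annihilates the residual.
  have hBD : ∀ k, B * D k = 0 := by
    intro k
    have h1 := hMD k
    rw [dualSlack, Matrix.sub_mul, Matrix.smul_mul, hQD, smul_zero, sub_zero] at h1
    exact h1
  have hcols : ∀ {E : Matrix (Fin Nt) (Fin Nt) ℂ}, B * E = 0 → ∀ j, B *ᵥ (fun i => E i j) = 0 :=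
    fun hE j => funext fun i => congrFun (congrFun hE i) j
  have hWD : ∀ k, W k = vecMulVec (u k) (star (u k)) + D k := fun k => by simp [D]
  have hW0 : ∀ k, W k ≠ 0 := by
    intro k h
    have := hs k
    rw [h] at this
    exact hsC k (by simpa using this.symm)
  by_cases hinj : ∃ v₀, v₀ ≠ 0 ∧ B *ᵥ v₀ = 0
  · right
    obtain ⟨v₀, hv₀, hBv₀⟩ := hinj
    obtain ⟨r₀, hr₀⟩ := hBker v₀ hBv₀
    have hr₀0 : r₀ ≠ 0 := by
      rintro rfl
      exact hv₀ (by simpa using hr₀)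
    have hline : ∀ {E : Matrix (Fin Nt) (Fin Nt) ℂ}, E.PosSemidef → B * E = 0 →
        ∃ r : ℝ, 0 ≤ r ∧ E = (r : ℂ) • vecMulVec v₀ (star v₀) := by
      intro E hE hBE
      refine exists_eq_smul_vecMulVec hE hv₀ fun j => ?_
      obtain ⟨r, hr⟩ := hBker _ (hcols hBE j)
      refine ⟨r / r₀, fun i => ?_⟩
      rw [hr₀]
      have := congrFun hr i
      simp only [Pi.smul_apply, smul_eq_mul] at this ⊢
      rw [this]
      field_simp
    refine ⟨v₀, hr₀ ▸ Submodule.smul_mem _ _ hv, hv₀, fun k hk => ?_, fun k => ?_⟩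
    · refine hline (hW k) ?_
      -- A user who sees `v₀` has multiplier zero, so its dual slack is `B` and all of `W k` lies on
      -- the line.
      have h1 := (multiplier_mul_eq_zero (hΓ k) (hl k) (hM k).1 hBv₀).resolve_right hk
      have h2 := (hM k).2
      rw [dualSlack, h1, zero_mul, zero_smul, sub_zero] at h2
      exact h2
    · obtain ⟨r, hr, hrD⟩ := hline (hD k) (hBD k)
      refine ⟨u k, r, hr, hrD ▸ hWD k, ?_⟩
      conv_rhs => rw [hWD k]
      rw [map_add, trIP_apply _ (D k), hQD]
      simp
  · left
    push Not at hinj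
    intro k
    have hD0 : D k = 0 := by
      ext i j
      by_contra h
      exact hinj (fun i => D k i j) (fun h0 => h (congrFun h0 i)) (hcols (hBD k) j)
    have h1 := hWD k
    rw [hD0, add_zero] at h1
    rw [h1]
    exact rank_vecMulVec_eq_one (h1 ▸ hW0 k)

/-! ### Attainment of the minimum -/

theorem isClosed_posSemidef {n : ℕ} : IsClosed {M : Matrix (Fin n) (Fin n) ℂ | M.PosSemidef} := by
  simp only [posSemidef_iff_dotProduct_mulVec, Set.ofPred_and, Set.ofPred_forall, IsHermitian]
  refine (isClosed_eq (by fun_prop) continuous_id).inter (isClosed_iInter fun x => ?_)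
  exact isClosed_le continuous_const
    (continuous_const.dotProduct (continuous_id.matrix_mulVec continuous_const))

/-- Cauchy–Schwarz on two coordinate vectors; this turns the power budget into an entrywise bound.
-/
theorem norm_apply_le_trace {n : ℕ} {W : Matrix (Fin n) (Fin n) ℂ} (hW : W.PosSemidef)
    (i j : Fin n) : ‖W i j‖ ≤ W.trace.re := by
  have hd : ∀ k, 0 ≤ (W k k).re := fun k => (Complex.nonneg_iff.1 hW.diag_nonneg).1
  have htr : ∀ k, (W k k).re ≤ W.trace.re := fun k => by
    rw [trace, Complex.re_sum]
    exact Finset.single_le_sum (f := fun k => (W k k).re) (fun k _ => hd k) (Finset.mem_univ k)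
  have h := norm_sq_form_le hW (Pi.single i 1) (Pi.single j 1)
  have he : ∀ k l, star (Pi.single k 1 : Fin n → ℂ) ⬝ᵥ W *ᵥ Pi.single l 1 = W k l := by
    intro k l
    rw [← Pi.single_star, star_one, single_one_dotProduct, mulVec_single_one]
    rfl
  rw [he, he, he] at h
  refine abs_le_of_sq_le_sq' ?_ ((hd i).trans (htr i)) |>.2
  rw [Complex.sq_norm, Complex.normSq_apply]
  nlinarith [mul_le_mul (htr i) (htr j) (hd j) ((hd i).trans (htr i))]

theorem continuous_trIP {n : ℕ} (M : Matrix (Fin n) (Fin n) ℂ) : Continuous (trIP M) :=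
  Complex.continuous_re.comp (continuous_const.matrix_mul continuous_id).matrix_trace

theorem continuous_crbMat (Nr : ℕ) {Nt : ℕ} (θ : ℝ) :
    Continuous fun p : Matrix (Fin Nt) (Fin Nt) ℂ × ℝ => crbMat Nr θ p.1 p.2 := by
  have h : ∀ M : Matrix (Fin Nt) (Fin Nt) ℂ,
      Continuous fun p : Matrix (Fin Nt) (Fin Nt) ℂ × ℝ => (M * p.1).trace := fun M =>
    (continuous_const.matrix_mul continuous_fst).matrix_trace
  refine continuous_matrix fun i j => ?_
  fin_cases i <;> fin_cases j
  · exact (h _).sub (Complex.continuous_ofReal.comp continuous_snd)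
  · exact h _
  · exact h _
  · exact h _

theorem isClosed_sdrFeasible {K Nt : ℕ} (Nr : ℕ) (θ : ℝ) (H : Matrix (Fin K) (Fin Nt) ℂ)
    (Γ : Fin K → ℝ) (σC PT : ℝ) :
    IsClosed {p : (Fin K → Matrix (Fin Nt) (Fin Nt) ℂ) × ℝ |
      SDRFeasible Nr θ H Γ σC PT p.1 p.2} := by
  have hW : ∀ k, Continuous fun p : (Fin K → Matrix (Fin Nt) (Fin Nt) ℂ) × ℝ => p.1 k :=
    fun k => (continuous_apply k).comp continuous_fst
  have hQ : ∀ k i, Continuous fun p : (Fin K → Matrix (Fin Nt) (Fin Nt) ℂ) × ℝ =>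
      (channelGram H k * p.1 i).trace.re := fun k i => (continuous_trIP _).comp (hW i)
  have heq : {p : (Fin K → Matrix (Fin Nt) (Fin Nt) ℂ) × ℝ |
      SDRFeasible Nr θ H Γ σC PT p.1 p.2} =
      {p | (crbMat Nr θ (∑ k, p.1 k) p.2).PosSemidef} ∩
      ((⋂ k, {p | Γ k * σC ^ 2 ≤ (channelGram H k * p.1 k).trace.re -
        Γ k * ∑ i ∈ Finset.univ.erase k, (channelGram H k * p.1 i).trace.re}) ∩
      ({p | ∑ k, (p.1 k).trace.re ≤ PT} ∩ ⋂ k, {p | (p.1 k).PosSemidef})) := by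
    ext p
    simp only [Set.mem_inter_iff, Set.mem_iInter, Set.mem_ofPred_eq]
    exact ⟨fun h => ⟨h.crb, h.sinr, h.power, h.psd⟩, fun h => ⟨h.1, h.2.1, h.2.2.1, h.2.2.2⟩⟩
  rw [heq]
  refine IsClosed.inter ?_ (IsClosed.inter (isClosed_iInter fun k => ?_)
    (IsClosed.inter ?_ (isClosed_iInter fun k => ?_)))
  · exact isClosed_posSemidef.preimage ((continuous_crbMat Nr θ).comp
      ((continuous_finsetSum _ fun k _ => hW k).prodMk continuous_snd))
  · exact isClosed_le continuous_const ((hQ k k).sub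
      (continuous_const.mul (continuous_finsetSum _ fun i _ => hQ k i)))
  · exact isClosed_le (continuous_finsetSum _ fun k _ =>
      Complex.continuous_re.comp (hW k).matrix_trace) continuous_const
  · exact isClosed_posSemidef.preimage (hW k)

/-- The relaxation attains its minimum. -/
theorem exists_sdrOptimal {K Nt Nr : ℕ} (hN : Nt < Nr) {θ : ℝ} {H : Matrix (Fin K) (Fin Nt) ℂ}
    {Γ : Fin K → ℝ} {σC PT : ℝ} (hrank : (H * steeringPair Nt θ).rank = 2)
    (hfeas : ∃ W t, SDRFeasible Nr θ H Γ σC PT W t) :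
    ∃ W t, SDROptimal Nr θ H Γ σC PT W t := by
  obtain ⟨c, e, na, nd, hc, he, -, -, hc0, he0, -⟩ := exists_steering_constants hN hrank
  let X : Set (Fin K → Matrix (Fin Nt) (Fin Nt) ℂ) :=
    Set.univ.pi fun _ => (Metric.closedBall (0 : ℂ) PT).matrix
  have hX : IsCompact X :=
    isCompact_univ_pi fun _ => (isCompact_closedBall (0 : ℂ) PT).matrix
  have hcont : Continuous fun W : Fin K → Matrix (Fin Nt) (Fin Nt) ℂ =>
      trIP (radarMat (steering Nt θ) (steeringDot Nt θ) c e) (∑ k, W k) :=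
    (continuous_trIP _).comp (continuous_finsetSum _ fun k _ => continuous_apply k)
  obtain ⟨T, hT⟩ := (hX.image hcont).bddAbove
  -- Only `t ≥ 0` competes, and the first diagonal entry of the Cramér–Rao matrix bounds `t` above,
  -- so this part of the feasible set is compact.
  let S : Set ((Fin K → Matrix (Fin Nt) (Fin Nt) ℂ) × ℝ) :=
    {p | SDRFeasible Nr θ H Γ σC PT p.1 p.2} ∩ {p | 0 ≤ p.2}
  have hSsub : S ⊆ X ×ˢ Set.Icc 0 T := by
    rintro ⟨W, t⟩ ⟨hf, ht⟩
    have hf : SDRFeasible Nr θ H Γ σC PT W t := hf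
    have hWX : W ∈ X := by
      intro k _ i j
      rw [mem_closedBall_zero_iff]
      refine (norm_apply_le_trace (hf.psd k) i j).trans (le_trans ?_ hf.power)
      exact Finset.single_le_sum (f := fun k => (W k).trace.re)
        (fun k _ => (Complex.nonneg_iff.1 (hf.psd k).trace_nonneg).1) (Finset.mem_univ k)
    refine ⟨hWX, ht, ?_⟩
    have h1 := ((crbMat_posSemidef_iff hc he
      (posSemidef_sum Finset.univ fun k _ => hf.psd k)).1 hf.crb).1
    exact (sub_nonneg.1 h1).trans (hT ⟨W, hWX, rfl⟩)
  have hS : IsCompact S := (hX.prod isCompact_Icc).of_isClosed_subset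
    ((isClosed_sdrFeasible Nr θ H Γ σC PT).inter
      (isClosed_le continuous_const continuous_snd)) hSsub
  obtain ⟨W₀, t₀, h₀⟩ := hfeas
  obtain ⟨⟨W, t⟩, ⟨hf, ht⟩, hmax⟩ := hS.exists_isMaxOn
    ⟨(W₀, 0), sdrFeasible_zero hc he hc0 he0 h₀, le_refl (0 : ℝ)⟩ continuous_snd.continuousOn
  refine ⟨W, t, hf, fun W' t' h' => neg_le_neg ?_⟩
  rcases le_total 0 t' with h | h
  · exact hmax (a := (W', t')) ⟨h', h⟩
  · exact h.trans ht

/-! ### Rank-one optima and the beamforming problem -/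

/-- With the covariance fixed, a gain in a user's own signal is an equal loss in its interference;
the other constraints see only the sum. -/
theorem SDRFeasible.of_sum_eq {K Nt Nr : ℕ} {θ : ℝ} {H : Matrix (Fin K) (Fin Nt) ℂ}
    {Γ : Fin K → ℝ} {σC PT t : ℝ} {W W' : Fin K → Matrix (Fin Nt) (Fin Nt) ℂ}
    (hΓ : ∀ k, 0 < Γ k) (h : SDRFeasible Nr θ H Γ σC PT W t) (hW' : ∀ k, (W' k).PosSemidef)
    (hsum : ∑ k, W' k = ∑ k, W k)
    (hQ : ∀ k, trIP (channelGram H k) (W k) ≤ trIP (channelGram H k) (W' k)) :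
    SDRFeasible Nr θ H Γ σC PT W' t := by
  refine ⟨hsum ▸ h.crb, fun k => ?_, ?_, hW'⟩
  · have h1 := h.sinr k
    have h2 := congrArg (trIP (channelGram H k)) hsum
    rw [map_sum, map_sum, ← Finset.add_sum_erase _ _ (Finset.mem_univ k),
      ← Finset.add_sum_erase _ _ (Finset.mem_univ k)] at h2
    simp only [trIP_apply] at h2 hQ
    have h3 := congrArg (Γ k * ·) h2
    simp only [mul_add] at h3
    linarith [mul_le_mul_of_nonneg_left (hQ k) (hΓ k).le, hQ k]
  · have h1 := h.power
    rw [← Complex.re_sum, ← trace_sum] at h1 ⊢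
    rwa [hsum]

theorem ne_zero_of_sdrFeasible {K Nt Nr : ℕ} {θ : ℝ} {H : Matrix (Fin K) (Fin Nt) ℂ}
    {Γ : Fin K → ℝ} {σC PT t : ℝ} {W : Fin K → Matrix (Fin Nt) (Fin Nt) ℂ}
    (hΓ : ∀ k, 0 < Γ k) (hσ : 0 < σC) (h : SDRFeasible Nr θ H Γ σC PT W t) (k : Fin K) :
    W k ≠ 0 := by
  intro h0
  have := signal_pos hΓ hσ h k
  simp [h0] at this

/-- Every optimal solution can be replaced by one of rank one with the same covariance. -/
theorem exists_rank_one_optimal {K Nt Nr : ℕ} (hN : Nt < Nr) {θ : ℝ}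
    {H : Matrix (Fin K) (Fin Nt) ℂ} {Γ : Fin K → ℝ} {σC PT t : ℝ}
    {W : Fin K → Matrix (Fin Nt) (Fin Nt) ℂ} (hΓ : ∀ k, 0 < Γ k) (hσ : 0 < σC)
    (hrank : (H * steeringPair Nt θ).rank = 2) (hopt : SDROptimal Nr θ H Γ σC PT W t) :
    ∃ W', SDROptimal Nr θ H Γ σC PT W' t ∧ ∑ k, W' k = ∑ k, W k ∧ ∀ k, (W' k).rank = 1 := by
  rcases optimal_structure hN hΓ hσ hrank hopt with h | ⟨v, hv, hv0, hline, hdec⟩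
  · exact ⟨W, hopt, rfl, h⟩
  obtain ⟨m, hm⟩ := exists_channel_ne_zero hrank hv hv0
  obtain ⟨q, hq, hWm⟩ := hline m hm
  choose u r hr hWu hQu using hdec
  have hvv : (vecMulVec v (star v)).PosSemidef := posSemidef_vecMulVec_self_star v
  -- User `m` receives every residual along `v`; the others keep only their rank-one part.
  let W' : Fin K → Matrix (Fin Nt) (Fin Nt) ℂ := fun k =>
    vecMulVec (u k) (star (u k)) + (if k = m then ∑ j, (r j : ℂ) else 0) • vecMulVec v (star v)
  have hρ : ∀ k, (0 : ℂ) ≤ if k = m then ∑ j, (r j : ℂ) else 0 := fun k => by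
    split_ifs
    · exact Finset.sum_nonneg fun j _ => Complex.zero_le_real.2 (hr j)
    · exact le_rfl
  have hW' : ∀ k, (W' k).PosSemidef := fun k =>
    (posSemidef_vecMulVec_self_star _).add (hvv.smul (hρ k))
  have hsum : ∑ k, W' k = ∑ k, W k := by
    simp only [W']
    rw [Finset.sum_congr rfl fun k _ => hWu k, Finset.sum_add_distrib, Finset.sum_add_distrib,
      ← Finset.sum_smul, ← Finset.sum_smul, Finset.sum_ite_eq' Finset.univ m]
    simp
  have hf : SDRFeasible Nr θ H Γ σC PT W' t := by
    refine hopt.1.of_sum_eq hΓ hW' hsum fun k => ?_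
    simp only [W']
    rw [map_add, hQu]
    exact le_add_of_nonneg_right
      (trace_mul_re_nonneg (posSemidef_vecMulVec_self_star _) (hvv.smul (hρ k)))
  refine ⟨W', ⟨hf, hopt.2⟩, hsum, fun k => ?_⟩
  have hne := ne_zero_of_sdrFeasible hΓ hσ hf k
  by_cases hk : k = m
  -- The rank-one part of user `m` is itself a multiple of `v vᴴ`, because `W m` is; the added
  -- residuals stay on that line.
  · have h1 : W' k = ((q : ℂ) - r m + ∑ j, (r j : ℂ)) • vecMulVec v (star v) := by
      have h2 := hWu m
      rw [hWm, ← sub_eq_iff_eq_add, ← sub_smul] at h2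
      simp only [W']
      rw [if_pos hk, hk, ← h2, ← add_smul]
    rw [h1] at hne ⊢
    exact rank_smul_vecMulVec_eq_one hne
  · have h1 : W' k = vecMulVec (u k) (star (u k)) := by
      simp only [W']
      rw [if_neg hk, zero_smul, add_zero]
    rw [h1] at hne ⊢
    exact rank_vecMulVec_eq_one hne

theorem trace_channelGram_mul_vecMulVec {K Nt : ℕ} (H : Matrix (Fin K) (Fin Nt) ℂ) (k : Fin K)
    (w : Fin Nt → ℂ) : (channelGram H k * vecMulVec w (star w)).trace.re =
      ‖star (channelVec H k) ⬝ᵥ w‖ ^ 2 := by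
  rw [trace_mul_vecMulVec_star, channelGram_mulVec, dotProduct_smul, star_dotProduct w,
    smul_eq_mul, Complex.star_def, Complex.mul_conj, Complex.ofReal_re, Complex.sq_norm]

/-- The beamforming problem is the relaxation restricted to outer squares. -/
theorem beamFeasible_iff {K Nt Nr : ℕ} {θ : ℝ} {H : Matrix (Fin K) (Fin Nt) ℂ}
    {Γ : Fin K → ℝ} {σC PT t : ℝ} (hσ : 0 < σC) {w : Fin K → Fin Nt → ℂ}
    {R : Matrix (Fin Nt) (Fin Nt) ℂ} :
    BeamFeasible Nr θ H Γ σC PT w R t ↔ R = ∑ k, vecMulVec (w k) (star (w k)) ∧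
      SDRFeasible Nr θ H Γ σC PT (fun k => vecMulVec (w k) (star (w k))) t := by
  have hs : ∀ k, (Γ k ≤ ‖star (channelVec H k) ⬝ᵥ w k‖ ^ 2 /
      (∑ i ∈ Finset.univ.erase k, ‖star (channelVec H k) ⬝ᵥ w i‖ ^ 2 + σC ^ 2)) ↔
      Γ k * σC ^ 2 ≤ (channelGram H k * vecMulVec (w k) (star (w k))).trace.re -
        Γ k * ∑ i ∈ Finset.univ.erase k,
          (channelGram H k * vecMulVec (w i) (star (w i))).trace.re := by
    intro k
    simp_rw [trace_channelGram_mul_vecMulVec]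
    rw [le_div_iff₀ (by positivity), mul_add, le_sub_iff_add_le, add_comm]
  constructor
  · intro h
    exact ⟨h.cov, h.cov ▸ h.crb, fun k => (hs k).1 (h.sinr k), h.power,
      fun k => posSemidef_vecMulVec_self_star _⟩
  · rintro ⟨rfl, h⟩
    exact ⟨h.crb, fun k => (hs k).2 (h.sinr k), h.power, rfl⟩

theorem SDROptimal.beamOptimal {K Nt Nr : ℕ} {θ : ℝ} {H : Matrix (Fin K) (Fin Nt) ℂ}
    {Γ : Fin K → ℝ} {σC PT t : ℝ} {W : Fin K → Matrix (Fin Nt) (Fin Nt) ℂ} (hσ : 0 < σC)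
    (hopt : SDROptimal Nr θ H Γ σC PT W t) {w : Fin K → Fin Nt → ℂ}
    (hw : ∀ k, W k = vecMulVec (w k) (star (w k))) :
    BeamOptimal Nr θ H Γ σC PT w (∑ k, W k) t := by
  obtain rfl : W = fun k => vecMulVec (w k) (star (w k)) := funext hw
  exact ⟨(beamFeasible_iff hσ).2 ⟨rfl, hopt.1⟩,
    fun w' R' t' h => hopt.2 _ t' ((beamFeasible_iff hσ).1 h).2⟩

end DFRC

end

theorem theorem2 {K Nt Nr : ℕ} (hK : K < Nt) (hN : Nt < Nr)
    (θ : ℝ) (H : Matrix (Fin K) (Fin Nt) ℂ) (Γ : Fin K → ℝ) (hΓ : ∀ k, 0 < Γ k)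
    (σC PT : ℝ) (hσ : 0 < σC)
    (hfeas : ∃ W t, DFRC.SDRFeasible Nr θ H Γ σC PT W t)
    (hrank : (H * DFRC.steeringPair Nt θ).rank = 2) :
    -- from every optimal solution, one with all ranks one and with the same covariance
    (∀ W t, DFRC.SDROptimal Nr θ H Γ σC PT W t →
      ∃ W', DFRC.SDROptimal Nr θ H Γ σC PT W' t ∧ ∑ k, W' k = ∑ k, W k ∧
        ∀ k, (W' k).rank = 1) ∧
    -- in every optimal solution, rank one for all users not orthogonal to some fixed direction
    (∀ W t, DFRC.SDROptimal Nr θ H Γ σC PT W t →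
      ∃ v ∈ Submodule.span ℂ {DFRC.steering Nt θ, DFRC.steeringDot Nt θ}, v ≠ 0 ∧
        ∀ k, star (DFRC.channelVec H k) ⬝ᵥ v ≠ 0 → (W k).rank = 1) ∧
    -- the relaxation is tight: both minima are attained, and they are equal
    (∃ c : ℝ, IsLeast {x | ∃ W t, DFRC.SDRFeasible Nr θ H Γ σC PT W t ∧ x = -t} c ∧
      IsLeast {x | ∃ w R t, DFRC.BeamFeasible Nr θ H Γ σC PT w R t ∧ x = -t} c) ∧
    -- optimal solutions with all ranks one are exactly factored by globally optimal beamformers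
    (∀ W t, DFRC.SDROptimal Nr θ H Γ σC PT W t → (∀ k, (W k).rank = 1) →
      (∃ w : Fin K → Fin Nt → ℂ, ∀ k, W k = vecMulVec (w k) (star (w k))) ∧
      ∀ w : Fin K → Fin Nt → ℂ, (∀ k, W k = vecMulVec (w k) (star (w k))) →
        DFRC.BeamOptimal Nr θ H Γ σC PT w (∑ k, W k) t) := by
  have hfactor : ∀ W t, DFRC.SDROptimal Nr θ H Γ σC PT W t → (∀ k, (W k).rank = 1) →
      ∃ w : Fin K → Fin Nt → ℂ, ∀ k, W k = vecMulVec (w k) (star (w k)) := fun W t hopt hr =>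
    Classical.skolem.1 fun k => DFRC.exists_eq_vecMulVec_of_rank_eq_one (hopt.1.psd k) (hr k)
  refine ⟨fun W t hopt => DFRC.exists_rank_one_optimal hN hΓ hσ hrank hopt, fun W t hopt => ?_, ?_,
    fun W t hopt hr => ⟨hfactor W t hopt hr, fun w hw => hopt.beamOptimal hσ hw⟩⟩
  · rcases DFRC.optimal_structure hN hΓ hσ hrank hopt with h | ⟨v, hv, hv0, hline, -⟩
    -- When all ranks are one, any nonzero vector of the span serves; the choice is `a`.
    · exact ⟨_, Submodule.subset_span (Set.mem_insert _ _),
        DFRC.steering_ne_zero (Nat.zero_lt_of_lt hK) θ, fun k _ => h k⟩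
    · refine ⟨v, hv, hv0, fun k hk => ?_⟩
      obtain ⟨r, -, hW⟩ := hline k hk
      have hne := DFRC.ne_zero_of_sdrFeasible hΓ hσ hopt.1 k
      rw [hW] at hne ⊢
      exact DFRC.rank_smul_vecMulVec_eq_one hne
  · obtain ⟨W₀, t, hopt₀⟩ := DFRC.exists_sdrOptimal hN hrank hfeas
    obtain ⟨W, hopt, -, hr⟩ := DFRC.exists_rank_one_optimal hN hΓ hσ hrank hopt₀
    obtain ⟨w, hw⟩ := hfactor W t hopt hr
    have hbeam := hopt.beamOptimal hσ hw
    refine ⟨-t, ⟨⟨W, t, hopt.1, rfl⟩, ?_⟩, ⟨⟨w, _, t, hbeam.1, rfl⟩, ?_⟩⟩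
    · rintro _ ⟨W', t', h', rfl⟩
      exact hopt.2 W' t' h'
    · rintro _ ⟨w', R', t', h', rfl⟩
      exact hbeam.2 w' R' t' h'
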